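/- Let $\lambda>0$, $p,q\in[0,1]$, $\alpha>2$, $v\ge 0$ and $s>0$, and put $p_A=p$, $p_B=1-p$. Device locations form a homogeneous Poisson point process $\Phi$ of intensity $\lambda$ on $\mathbb{R}^2$. Each device $y\in\Phi$ carries a mark consisting of a cached file portion, which is $A$ with probability $p_A$ and $B$ with probability $p_B$, an activity indicator $t_y\in\{0,1\}$ with $\mathbb{P}(t_y=1)=q$, and a fading power $h_y$ that is exponentially distributed with mean $1$; the three components are independent, and the marks are independent of each other and of $\Phi$. Let $\Phi_B$ be the set of devices that cache $B$. Location 1 is $(-v,0)$ and location 2 is the origin. Let $R_1$ be the distance from location 1 to the closest device, and let $\mathcal{Y}$ be the event that this closest device caches $B$. For $r_1>0$ let $\mathcal{C}_1$ be the closed disc of radius $r_1$ centred at location 1, and let $$I_2=\sum_{y\in\Phi_B\setminus\mathcal{C}_1}t_y h_y\|y\|^{-\alpha}.$$ Then $I_2$ is almost surely finite, and the conditional Laplace transform of $I_2$ under $\mathcal{Y}$, given $R_1=r_1$, is $$\mathcal{L}_{I_2|R_1}(s|r_1)=\exp\left(-2p_Bq\lambda\left(\int_{z_1}^{\infty}\frac{\pi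 r\,\mathrm{d}r}{1+\frac{r^{\alpha}}{s}}-\int_{|v-r_1|}^{v+r_1}\frac{f(r,r_1)\,r\,\mathrm{d}r}{1+\frac{r^{\alpha}}{s}}\right)\right),$$ where $z_1=\max(0,r_1-v)$ and $f(r,r_1)=\arccos\left(\frac{r^2+v^2-r_1^2}{2rv}\right)$, and both integrals converge. That is: if $p_B>0$ and $\mathcal{C}_1$ has the random radius $r_1=R_1$, then $\mathbb{E}\left[e^{-sI_2}\mid R_1,\mathcal{Y}\right]=\mathcal{L}_{I_2|R_1}(s|R_1)$ almost surely on $\mathcal{Y}$; and for every fixed radius $r_1>0$ of the exclusion disc, $\mathbb{E}\left[e^{-sI_2}\right]=\mathcal{L}_{I_2|R_1}(s|r_1)$. (For $v=0$ the second integral is over a degenerate interval and is $0$.) -/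

import Mathlib

open MeasureTheory ProbabilityTheory Set

noncomputable section

namespace D2DCaching

/-- The Euclidean plane in which the devices live. -/
abbrev Plane : Type := EuclideanSpace ℝ (Fin 2)

/-- The two file portions. -/
inductive FilePortion : Type
  | A : FilePortion
  | B : FilePortion

instance : MeasurableSpace FilePortion := ⊤

/-- Location 1, the point `(-v, 0)`. Location 2 is the origin. -/
def location1 (v : ℝ) : Plane := !₂[-v, 0]

/-- The number of indices `n` for which the random point `X n` lies in `S`. -/
def pointCount {Ω : Type*} (X : ℕ → Ω → Plane) (S : Set Plane) (ω : Ω) : ℕ∞ :=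
  {n : ℕ | X n ω ∈ S}.encard

/-- The random points `X 0, X 1, …` enumerate a homogeneous Poisson point process of intensity
`lam` on the plane: the number of points in a Borel set of finite area is Poisson distributed with
mean `lam` times the area, and the numbers of points in disjoint such sets are independent. -/
structure IsHomogeneousPPP {Ω : Type*} [MeasurableSpace Ω] (P : Measure Ω) (lam : ℝ)
    (X : ℕ → Ω → Plane) : Prop where
  measurable_point : ∀ n, Measurable (X n)
  count_law : ∀ S : Set Plane, MeasurableSet S → volume S < ⊤ →
    HasLaw (pointCount X S)
      ((poissonMeasure (ENNReal.ofReal lam * volume S).toNNReal).map (Nat.cast : ℕ → ℕ∞)) P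
  count_indep : ∀ (k : ℕ) (S : Fin k → Set Plane), (∀ i, MeasurableSet (S i)) →
    (∀ i, volume (S i) < ⊤) → Pairwise (fun i j => Disjoint (S i) (S j)) →
    iIndepFun (fun i => pointCount X (S i)) P

/-- The caching network. Device `n` sits at the random position `X n`, caches the file portion
`file n`, has the activity indicator `t n ∈ {0, 1}` and the fading power `h n`. The positions form a
homogeneous Poisson point process of intensity `lam`. The marks `(file n, t n, h n)` of the devices
are independent of the positions and of each other, and in each of them the three components are
independent: the file portion is `A` with probability `p` and `B` with probability `1 - p`, the
indicator is `1` with probability `q`, and the fading is exponential with mean `1`. -/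
structure IsCachingNetwork {Ω : Type*} [MeasurableSpace Ω] (P : Measure Ω) (lam : ℝ)
    (p q : unitInterval) (X : ℕ → Ω → Plane) (file : ℕ → Ω → FilePortion)
    (t h : ℕ → Ω → ℝ) : Prop where
  ppp : IsHomogeneousPPP P lam X
  measurable_file : ∀ n, Measurable (file n)
  measurable_t : ∀ n, Measurable (t n)
  measurable_h : ∀ n, Measurable (h n)
  mark_law : ∀ n, HasLaw (fun ω => (file n ω, t n ω, h n ω))
    ((bernoulliMeasure FilePortion.A FilePortion.B p).prod
      ((bernoulliMeasure (1 : ℝ) 0 q).prod (expMeasure 1))) P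
  mark_indep : iIndepFun (fun n ω => (file n ω, t n ω, h n ω)) P
  position_indep_mark :
    IndepFun (fun ω (n : ℕ) => X n ω) (fun ω (n : ℕ) => (file n ω, t n ω, h n ω)) P

/-- The distance `R₁` from location 1 to the closest device. -/
def servingDistance {Ω : Type*} (v : ℝ) (X : ℕ → Ω → Plane) (ω : Ω) : ℝ :=
  ⨅ n, dist (location1 v) (X n ω)

/-- The subcase in which file 1 is file B: a device closest to location 1 caches file B. -/
def subcaseY {Ω : Type*} (v : ℝ) (X : ℕ → Ω → Plane) (file : ℕ → Ω → FilePortion) : Set Ω :=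
  {ω | ∃ n, (∀ m, dist (location1 v) (X n ω) ≤ dist (location1 v) (X m ω)) ∧
    file n ω = FilePortion.B}

open Classical in
/-- The power received at location 2 from device `n`, if it caches file B and lies outside the
disc `C₁` of radius `r₁` centred at location 1; zero for all other devices. -/
def interferenceTerm {Ω : Type*} (α v r₁ : ℝ) (X : ℕ → Ω → Plane) (file : ℕ → Ω → FilePortion)
    (t h : ℕ → Ω → ℝ) (ω : Ω) (n : ℕ) : ℝ :=
  if file n ω = FilePortion.B ∧ X n ω ∉ Metric.closedBall (location1 v) r₁ then
    t n ω * h n ω * ‖X n ω‖ ^ (-α)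
  else 0

/-- The interference power `I₂` at location 2 from all devices that cache file B and lie outside
the disc `C₁` of radius `r₁` centred at location 1. -/
def interferenceTwo {Ω : Type*} (α v r₁ : ℝ) (X : ℕ → Ω → Plane) (file : ℕ → Ω → FilePortion)
    (t h : ℕ → Ω → ℝ) (ω : Ω) : ℝ :=
  ∑' n, interferenceTerm α v r₁ X file t h ω n

/-- The angle `f(r, r₁)`. -/
def angle (v r r₁ : ℝ) : ℝ := Real.arccos ((r ^ 2 + v ^ 2 - r₁ ^ 2) / (2 * r * v))

/-- The claimed value `L(s | r₁)` of the conditional Laplace transform, with `pB` the probability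
that a device caches file B. -/
def laplaceTwo (lam pB q α v s r₁ : ℝ) : ℝ :=
  Real.exp (-2 * pB * q * lam *
    ((∫ r in Ioi (max 0 (r₁ - v)), Real.pi * r / (1 + r ^ α / s)) -
      ∫ r in |v - r₁|..(v + r₁), angle v r r₁ * r / (1 + r ^ α / s)))

end D2DCaching

end

/-! For non-negative marks, `exp (-s I₂)` is a product over the devices of factors in `[0, 1]`.
Freezing the positions and averaging the independent marks replaces each factor by a function `g` of
the position alone, with `1 - g y = (1 - p) q / (1 + ‖y‖ ^ α / s)` outside the disc
(`one_sub_meanWeight`) and `0` inside. The Laplace functional of the Poisson process, `E ∏ g (X n) =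
exp (-lam ∫ (1 - g))` (`lintegral_infProd`), then gives the transform for a fixed radius. In polar
coordinates around location 2, a circle of radius `r` loses to the disc an arc whose half-angle is
given by the law of cosines; this turns the area integral into the stated difference of two
integrals (`integral_arc`).

Two further facts carry the conditional statement. First, the event `R₁ ≥ a` concerns only the open
ball of radius `a` around location 1, so it is independent of what happens beyond any radius `r ≥
a`. Approximating `R₁` from above by grid values and using right-continuity in the radius extends
this to the random radius `R₁` itself (`setLIntegral_minDist`). Secondly, the closest device is
almost surely unique (`ae_dist_injective`) and lies in the closed disc, so its mark does not enter
`I₂`: the event that it caches B contributes a bare factor `1 - p` (`setLIntegral_closestB`), which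
also multiplies the law of `R₁` on that event and so drops out of the comparison.

Finiteness of the interference follows from Campbell's formula outside the unit disc, where `‖y‖ ^
(-α)` is integrable because `α > 2`, and from local finiteness inside. Products, means and limits
are handled in `ℝ≥0∞`, where an infinite product of factors at most `1` always exists as a
decreasing limit. -/

open Filter
open scoped ENNReal NNReal Topology

/-! ### Infinite products of factors in `[0, 1]`. -/

namespace D2DCaching

/-- The infinite product of a sequence of extended nonnegative reals that are at most `1`. -/
noncomputable def infProd (a : ℕ → ℝ≥0∞) : ℝ≥0∞ := ⨅ N, ∏ n ∈ Finset.range N, a n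

lemma antitone_prod_range {a : ℕ → ℝ≥0∞} (ha : ∀ n, a n ≤ 1) :
    Antitone fun N => ∏ n ∈ Finset.range N, a n := by
  refine antitone_nat_of_succ_le fun N => ?_
  rw [Finset.prod_range_succ]
  exact mul_le_of_le_one_right' (ha N)

lemma tendsto_infProd {a : ℕ → ℝ≥0∞} (ha : ∀ n, a n ≤ 1) :
    Filter.Tendsto (fun N => ∏ n ∈ Finset.range N, a n) Filter.atTop (𝓝 (infProd a)) :=
  tendsto_atTop_iInf (antitone_prod_range ha)

lemma infProd_le_one (a : ℕ → ℝ≥0∞) : infProd a ≤ 1 :=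
  (iInf_le _ 0).trans (by simp)

lemma infProd_ne_top (a : ℕ → ℝ≥0∞) : infProd a ≠ ⊤ :=
  ((infProd_le_one a).trans_lt ENNReal.one_lt_top).ne

lemma infProd_mono {a b : ℕ → ℝ≥0∞} (h : ∀ n, a n ≤ b n) : infProd a ≤ infProd b :=
  iInf_mono fun _ => Finset.prod_le_prod' fun n _ => h n

lemma prod_le_one_ennreal {ι : Type*} {s : Finset ι} {a : ι → ℝ≥0∞} (ha : ∀ n, a n ≤ 1) :
    ∏ n ∈ s, a n ≤ 1 := Finset.prod_le_one' fun n _ => ha n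

lemma infProd_mul {a b : ℕ → ℝ≥0∞} (ha : ∀ n, a n ≤ 1) (hb : ∀ n, b n ≤ 1) :
    infProd (fun n => a n * b n) = infProd a * infProd b := by
  refine tendsto_nhds_unique (tendsto_infProd fun n => mul_le_one' (ha n) (hb n)) ?_
  simp_rw [Finset.prod_mul_distrib]
  exact ENNReal.Tendsto.mul (tendsto_infProd ha) (Or.inr (infProd_ne_top b)) (tendsto_infProd hb)
    (Or.inr (infProd_ne_top a))

lemma infProd_one : infProd (fun _ => 1) = 1 := by simp [infProd]

lemma infProd_prod {ι : Type*} (s : Finset ι) {a : ι → ℕ → ℝ≥0∞} (ha : ∀ i n, a i n ≤ 1) :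
    infProd (fun n => ∏ i ∈ s, a i n) = ∏ i ∈ s, infProd (a i) := by
  classical
  induction s using Finset.induction_on with
  | empty => simp [infProd_one]
  | insert i s hi ih =>
    simp_rw [Finset.prod_insert hi]
    rw [infProd_mul (ha i) fun n => prod_le_one_ennreal fun j => ha j n, ih]

-- Beyond the largest element of `T` the partial products no longer change. This links products over
-- devices with point counts.
open Classical in
lemma infProd_ite_pow {T : Set ℕ} (hT : T.Finite) {c : ℝ≥0∞} (hc : c ≤ 1) :
    infProd (fun n => if n ∈ T then c else 1) = c ^ T.ncard := by
  refine tendsto_nhds_unique (tendsto_infProd fun n => by split_ifs <;> simp [hc]) ?_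
  refine tendsto_const_nhds.congr' ?_
  obtain ⟨M, hM⟩ := hT.bddAbove
  filter_upwards [Filter.eventually_gt_atTop M] with N hN
  rw [Finset.prod_ite, Finset.prod_const_one, mul_one, Finset.prod_const,
    Set.ncard_eq_toFinset_card T hT]
  congr 2
  ext n
  simp only [Finite.mem_toFinset, Finset.mem_filter, Finset.mem_range]
  exact ⟨fun h => ⟨(hM h).trans_lt hN, h⟩, fun h => h.2⟩

lemma infProd_single (n₀ : ℕ) {c : ℝ≥0∞} (hc : c ≤ 1) :
    infProd (fun n => if n = n₀ then c else 1) = c := by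
  classical
  simpa using infProd_ite_pow (Set.finite_singleton n₀) hc

lemma infProd_eq_zero {a : ℕ → ℝ≥0∞} {n : ℕ} (h : a n = 0) : infProd a = 0 := by
  refine le_antisymm ((iInf_le _ (n + 1)).trans ?_) bot_le
  simp [Finset.prod_range_succ, h]

open Classical in
lemma infProd_indicator (p : ℕ → Prop) :
    infProd (fun n => if p n then 1 else 0) = if ∀ n, p n then 1 else 0 := by
  split_ifs with h
  · simp [h, infProd_one]
  · push Not at h
    obtain ⟨n, hn⟩ := h
    exact infProd_eq_zero (n := n) (by simp [hn])

lemma tendsto_prod_ennreal {ι κ : Type*} {l : Filter κ} (s : Finset ι) {f : κ → ι → ℝ≥0∞}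
    {a : ι → ℝ≥0∞} (ha : ∀ i, a i ≤ 1) (h : ∀ i, Filter.Tendsto (fun k => f k i) l (𝓝 (a i))) :
    Filter.Tendsto (fun k => ∏ i ∈ s, f k i) l (𝓝 (∏ i ∈ s, a i)) := by
  classical
  induction s using Finset.induction_on with
  | empty => simpa using tendsto_const_nhds
  | insert i s hi ih =>
    simp_rw [Finset.prod_insert hi]
    exact ENNReal.Tendsto.mul (h i)
      (Or.inr ((prod_le_one_ennreal ha).trans_lt ENNReal.one_lt_top).ne) ih
      (Or.inr ((ha i).trans_lt ENNReal.one_lt_top).ne)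

/-- Two infima commute, and a finite product of decreasing bounded factors passes to the limit. It
serves both the monotone approximation in the Laplace functional and the right-continuity in the
radius. -/
lemma infProd_iInf {a : ℕ → ℕ → ℝ≥0∞} (ha : ∀ k n, a k n ≤ 1) (hanti : ∀ n, Antitone fun k => a k n) :
    infProd (fun n => ⨅ k, a k n) = ⨅ k, infProd (a k) := by
  unfold infProd
  rw [iInf_comm]
  refine iInf_congr fun N => ?_
  refine tendsto_nhds_unique (tendsto_prod_ennreal _ (fun n => (iInf_le _ 0).trans (ha 0 n))
    fun n => tendsto_atTop_iInf (hanti n)) (tendsto_atTop_iInf fun k l hkl => ?_)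
  exact Finset.prod_le_prod' fun n _ => hanti n hkl

lemma infProd_exp {b : ℕ → ℝ} (hb : ∀ n, 0 ≤ b n) (hs : Summable b) :
    infProd (fun n => ENNReal.ofReal (Real.exp (-b n))) =
      ENNReal.ofReal (Real.exp (-∑' n, b n)) := by
  refine tendsto_nhds_unique (tendsto_infProd fun n => ?_) ?_
  · simpa using hb n
  · have : ∀ N, ∏ n ∈ Finset.range N, ENNReal.ofReal (Real.exp (-b n)) =
        ENNReal.ofReal (Real.exp (-∑ n ∈ Finset.range N, b n)) := fun N => by
      rw [← ENNReal.ofReal_prod_of_nonneg fun n _ => (Real.exp_pos _).le, ← Real.exp_sum,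
        Finset.sum_neg_distrib]
    simp_rw [this]
    exact ENNReal.tendsto_ofReal
      ((Real.continuous_exp.tendsto _).comp hs.hasSum.tendsto_sum_nat.neg)

lemma measurable_infProd {Ω : Type*} [MeasurableSpace Ω] {a : ℕ → Ω → ℝ≥0∞}
    (ha : ∀ n, Measurable (a n)) : Measurable fun ω => infProd fun n => a n ω :=
  Measurable.iInf fun _ => Finset.measurable_prod _ fun n _ => ha n

end D2DCaching

/-! ### Poisson counts, the intensity measure and Campbell's formula. -/

namespace D2DCaching

lemma lintegral_poissonMeasure (μ : ℝ≥0) (F : ℕ → ℝ≥0∞) :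
    ∫⁻ n, F n ∂(poissonMeasure μ) =
      ∑' n, ENNReal.ofReal (Real.exp (-μ) * μ ^ n / n.factorial) * F n := by
  rw [poissonMeasure, lintegral_sum_measure]
  simp [lintegral_smul_measure]

lemma lintegral_pow_poissonMeasure (μ : ℝ≥0) {c : ℝ} (hc : 0 ≤ c) :
    ∫⁻ n, ENNReal.ofReal c ^ n ∂(poissonMeasure μ) =
      ENNReal.ofReal (Real.exp (-(μ * (1 - c)))) := by
  rw [lintegral_poissonMeasure]
  have h : HasSum (fun n : ℕ => Real.exp (-μ) * ((μ * c) ^ n / n.factorial))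
      (Real.exp (-μ) * Real.exp (μ * c)) := by
    rw [Real.exp_eq_exp_ℝ]
    exact (NormedSpace.expSeries_div_hasSum_exp (μ * c : ℝ)).mul_left _
  rw [show -(μ * (1 - c) : ℝ) = -μ + μ * c by ring, Real.exp_add, ← h.tsum_eq,
    ENNReal.ofReal_tsum_of_nonneg (fun n => by positivity) h.summable]
  refine tsum_congr fun n => ?_
  rw [← ENNReal.ofReal_pow hc, ← ENNReal.ofReal_mul (by positivity)]
  congr 1
  rw [mul_pow]
  ring

lemma lintegral_id_poissonMeasure (μ : ℝ≥0) :
    ∫⁻ n, (n : ℝ≥0∞) ∂(poissonMeasure μ) = μ := by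
  rw [lintegral_poissonMeasure, tsum_eq_zero_add' ENNReal.summable]
  have h : HasSum (fun n : ℕ => Real.exp (-μ) * μ ^ n / n.factorial * (μ : ℝ)) (1 * μ) :=
    (hasSum_one_poissonMeasure μ).mul_right _
  have : (μ : ℝ≥0∞) = ENNReal.ofReal (1 * μ) := by simp
  rw [this, ← h.tsum_eq, ENNReal.ofReal_tsum_of_nonneg (fun n => by positivity) h.summable]
  simp only [Nat.cast_zero, mul_zero, zero_add]
  refine tsum_congr fun n => ?_
  rw [← ENNReal.ofReal_natCast, ← ENNReal.ofReal_mul (by positivity)]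
  congr 1
  rw [Nat.factorial_succ]
  push_cast
  field_simp
  ring

/-- The complement has mass `exp (-μ) * (1 + μ)`, and `exp (-μ) ≥ 1 - μ` bounds this below by `1 - μ
^ 2`. -/
lemma poissonMeasure_two_le (μ : ℝ≥0) : poissonMeasure μ {n | 2 ≤ n} ≤ ENNReal.ofReal (μ ^ 2) := by
  have hc : {n : ℕ | 2 ≤ n} = ({0, 1} : Set ℕ)ᶜ := by
    ext n; simp; omega
  rw [hc, prob_compl_eq_one_sub (by measurability), Set.insert_eq,
    measure_union (by simp) (by measurability), poissonMeasure_singleton,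
    poissonMeasure_singleton, ← ENNReal.ofReal_add (by positivity) (by positivity),
    ← ENNReal.ofReal_one, ← ENNReal.ofReal_sub _ (by positivity)]
  refine ENNReal.ofReal_le_ofReal ?_
  have h := Real.add_one_le_exp (-(μ : ℝ))
  have h0 : (0 : ℝ) ≤ μ := μ.2
  simp
  nlinarith

variable {Ω : Type*} [MeasurableSpace Ω] {P : Measure Ω} {lam : ℝ} {X : ℕ → Ω → Plane}

namespace IsHomogeneousPPP

lemma lintegral_count (hX : IsHomogeneousPPP P lam X) {S : Set Plane} (hS : MeasurableSet S)
    (hv : volume S < ⊤) {F : ℕ∞ → ℝ≥0∞} (hF : Measurable F) :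
    ∫⁻ ω, F (pointCount X S ω) ∂P =
      ∫⁻ n : ℕ, F n ∂(poissonMeasure (ENNReal.ofReal lam * volume S).toNNReal) := by
  rw [(hX.count_law S hS hv).lintegral_comp hF.aemeasurable,
    lintegral_map hF .of_discrete]

lemma ae_finite (hX : IsHomogeneousPPP P lam X) {S : Set Plane} (hS : MeasurableSet S)
    (hv : volume S < ⊤) : ∀ᵐ ω ∂P, {n | X n ω ∈ S}.Finite := by
  have hm : Measurable fun N : ℕ∞ => N ≠ ⊤ := by
    exact .of_discrete
  have := ((hX.count_law S hS hv).ae_iff hm).2 (by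
    rw [ae_map_iff .of_discrete .of_discrete]
    exact Filter.Eventually.of_forall fun n => ENat.natCast_ne_top n)
  filter_upwards [this] with ω hω
  exact Set.encard_ne_top_iff.1 hω

lemma lintegral_pow_count (hX : IsHomogeneousPPP P lam X) (hlam : 0 < lam)
    {S : Set Plane} (hS : MeasurableSet S)
    (hv : volume S < ⊤) {c : ℝ≥0∞} (hc : c ≤ 1) :
    ∫⁻ ω, c ^ {n | X n ω ∈ S}.ncard ∂P =
      ENNReal.ofReal (Real.exp (-(lam * ((1 - c) * volume S).toReal))) := by
  -- `ENat.toNat` sends `⊤` to `0`, just as `Set.ncard` does for infinite sets, so no null set has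
  -- to be discarded.
  have hF : Measurable fun N : ℕ∞ => c ^ N.toNat := .of_discrete
  have := hX.lintegral_count hS hv hF
  have hct : c ≠ ⊤ := (hc.trans_lt ENNReal.one_lt_top).ne
  simp only [ENat.toNat_natCast] at this
  rw [← ENNReal.ofReal_toReal hct, lintegral_pow_poissonMeasure _ ENNReal.toReal_nonneg,
    ENNReal.ofReal_toReal hct] at this
  refine this.trans ?_
  congr 3
  rw [ENNReal.coe_toNNReal_eq_toReal, ENNReal.toReal_mul, ENNReal.toReal_mul,
    ENNReal.toReal_ofReal hlam.le, ENNReal.toReal_sub_of_le hc ENNReal.one_ne_top]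
  simp
  ring

lemma lintegral_encard (hX : IsHomogeneousPPP P lam X) {S : Set Plane} (hS : MeasurableSet S)
    (hv : volume S < ⊤) :
    ∫⁻ ω, ((pointCount X S ω : ℕ∞) : ℝ≥0∞) ∂P = ENNReal.ofReal lam * volume S := by
  rw [hX.lintegral_count hS hv (F := fun N => (N : ℝ≥0∞)) .of_discrete]
  simp only [ENat.toENNReal_coe]
  rw [lintegral_id_poissonMeasure, ENNReal.coe_toNNReal]
  exact ENNReal.mul_ne_top ENNReal.ofReal_ne_top hv.ne

lemma measure_two_le_count (hX : IsHomogeneousPPP P lam X) (hlam : 0 < lam) {S : Set Plane}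
    (hS : MeasurableSet S) (hv : volume S < ⊤) :
    P {ω | 2 ≤ pointCount X S ω} ≤ ENNReal.ofReal ((lam * (volume S).toReal) ^ 2) := by
  rw [(hX.count_law S hS hv).measure_eq (p := fun N : ℕ∞ => 2 ≤ N) .of_discrete,
    Measure.map_apply .of_discrete .of_discrete]
  have : (Nat.cast ⁻¹' {N : ℕ∞ | 2 ≤ N} : Set ℕ) = {n | 2 ≤ n} := by
    ext n
    simp only [mem_preimage, mem_ofPred_eq]
    exact_mod_cast Iff.rfl
  rw [this]
  refine (poissonMeasure_two_le _).trans (le_of_eq ?_)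
  rw [ENNReal.coe_toNNReal_eq_toReal, ENNReal.toReal_mul, ENNReal.toReal_ofReal hlam.le]

/-- The intensity measure of a homogeneous Poisson process. -/
lemma sum_map_eq (hX : IsHomogeneousPPP P lam X) :
    Measure.sum (fun n => P.map (X n)) = ENNReal.ofReal lam • (volume : Measure Plane) := by
  have key : ∀ S : Set Plane, MeasurableSet S → volume S < ⊤ →
      Measure.sum (fun n => P.map (X n)) S = (ENNReal.ofReal lam • (volume : Measure Plane)) S := by
    intro S hS hv
    rw [Measure.sum_apply _ hS, Measure.smul_apply, smul_eq_mul, ← hX.lintegral_encard hS hv]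
    have : ∀ ω, ((pointCount X S ω : ℕ∞) : ℝ≥0∞) =
        ∑' n, (X n ⁻¹' S).indicator (fun _ => (1 : ℝ≥0∞)) ω := fun ω => by
      rw [pointCount, ← ENNReal.tsum_set_one]
      refine (tsum_subtype {n | X n ω ∈ S} fun _ => (1 : ℝ≥0∞)).trans (tsum_congr fun n => ?_)
      simp only [indicator, mem_preimage]
      rfl
    simp_rw [this]
    rw [lintegral_tsum fun n =>
      (measurable_const.indicator (hX.measurable_point n hS)).aemeasurable]
    refine tsum_congr fun n => ?_
    rw [Measure.map_apply (hX.measurable_point n) hS,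
      lintegral_indicator (hX.measurable_point n hS)]
    simp
  -- The law of the counts is known only on sets of finite area; an exhaustion of the plane by such
  -- sets yields equality of the measures.
  have hr : ∀ n, (Measure.sum (fun n => P.map (X n))).restrict
        (spanningSets (volume : Measure Plane) n) =
      (ENNReal.ofReal lam • (volume : Measure Plane)).restrict (spanningSets volume n) := by
    intro n
    ext S hS
    rw [Measure.restrict_apply hS, Measure.restrict_apply hS]
    exact key _ (hS.inter (measurableSet_spanningSets _ n))
      ((measure_mono inter_subset_right).trans_lt (measure_spanningSets_lt_top _ n))
  exact Measure.ext_of_iUnion_eq_univ (iUnion_spanningSets _) hr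

/-- Campbell's formula. -/
lemma lintegral_tsum (hX : IsHomogeneousPPP P lam X) {f : Plane → ℝ≥0∞} (hf : Measurable f) :
    ∑' n, ∫⁻ ω, f (X n ω) ∂P = ENNReal.ofReal lam * ∫⁻ x, f x := by
  rw [← smul_eq_mul, ← lintegral_smul_measure, ← hX.sum_map_eq, lintegral_sum_measure]
  exact tsum_congr fun n => (lintegral_map hf (hX.measurable_point n)).symm

end IsHomogeneousPPP
end D2DCaching

/-! ### The Laplace functional of the Poisson process. -/

namespace D2DCaching

variable {Ω : Type*} [MeasurableSpace Ω] {P : Measure Ω} {lam : ℝ} {X : ℕ → Ω → Plane}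

/-- Almost everywhere measurability is the right generality here: `HasLaw` gives no more for the
point counts. -/
lemma lintegral_prod_of_iIndepFun {ι : Type*} (s : Finset ι) {f : ι → Ω → ℝ≥0∞}
    [Countable ι] (hf : iIndepFun f P) (hm : ∀ i, AEMeasurable (f i) P) :
    ∫⁻ ω, ∏ i ∈ s, f i ω ∂P = ∏ i ∈ s, ∫⁻ ω, f i ω ∂P := by
  have h : ∀ᵐ ω ∂P, ∀ i, f i ω = (hm i).mk (f i) ω := ae_all_iff.2 fun i => (hm i).ae_eq_mk
  have h1 : ∫⁻ ω, ∏ i ∈ s, f i ω ∂P = ∫⁻ ω, ∏ i ∈ s, (hm i).mk (f i) ω ∂P :=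
    lintegral_congr_ae (h.mono fun ω hω => Finset.prod_congr rfl fun i _ => hω i)
  rw [h1, lintegral_prod_eq_prod_lintegral_of_indepFun s _
    (hf.congr fun i => (hm i).ae_eq_mk) fun i => (hm i).measurable_mk]
  exact Finset.prod_congr rfl fun i _ => lintegral_congr_ae (hm i).ae_eq_mk.symm

namespace IsHomogeneousPPP

lemma iIndepFun_count (hX : IsHomogeneousPPP P lam X) {ι : Type*} [Fintype ι]
    {S : ι → Set Plane} (hS : ∀ i, MeasurableSet (S i)) (hv : ∀ i, volume (S i) < ⊤)
    (hd : Pairwise fun i j => Disjoint (S i) (S j)) :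
    iIndepFun (fun i => pointCount X (S i)) P := by
  classical
  let e := Fintype.equivFin ι
  have := hX.count_indep (Fintype.card ι) (fun i => S (e.symm i)) (fun i => hS _) (fun i => hv _)
    fun i j hij => hd (e.symm.injective.ne hij)
  simpa using this.precomp e.injective

-- A simple function splits `K` into level sets with independent Poisson counts. A point in the
-- level set of `c` contributes the factor `1 - c`, so the mean is a product of Poisson generating
-- functions, and the exponents add up to the integral.
open Classical in
lemma lintegral_infProd_simple [IsProbabilityMeasure P] (hX : IsHomogeneousPPP P lam X)
    (hlam : 0 < lam)
    (φ : SimpleFunc Plane ℝ≥0∞) (hφ : ∀ x, φ x ≤ 1) {K : Set Plane} (hK : MeasurableSet K)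
    (hKv : volume K < ⊤) :
    ∫⁻ ω, infProd (fun n => 1 - K.indicator φ (X n ω)) ∂P =
      ENNReal.ofReal (Real.exp (-(lam * (∫⁻ x, K.indicator φ x).toReal))) := by
  let S : φ.range → Set Plane := fun c => φ ⁻¹' {c.1} ∩ K
  have hS : ∀ c, MeasurableSet (S c) := fun c => (φ.measurableSet_fiber _).inter hK
  have hv : ∀ c, volume (S c) < ⊤ := fun c => (measure_mono inter_subset_right).trans_lt hKv
  have hd : Pairwise fun c d => Disjoint (S c) (S d) := fun c d hcd => by
    refine Set.disjoint_left.2 fun x hx hx' => hcd ?_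
    have h1 : φ x = c.1 := hx.1
    have h2 : φ x = d.1 := hx'.1
    exact Subtype.ext (h1.symm.trans h2)
  have hc1 : ∀ c : φ.range, c.1 ≤ 1 := fun c => by
    obtain ⟨x, hx⟩ := SimpleFunc.mem_range.1 c.2
    exact hx ▸ hφ x
  have hg : ∀ x, 1 - K.indicator φ x = ∏ c : φ.range, if x ∈ S c then 1 - c.1 else 1 := by
    intro x
    by_cases hx : x ∈ K
    · rw [Fintype.prod_eq_single ⟨φ x, φ.mem_range_self x⟩]
      · simp [S, hx]
      · intro c hc
        rw [if_neg]
        intro h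
        exact hc (Subtype.ext h.1.symm)
    · simp [S, hx]
  have h1 : ∀ᵐ ω ∂P, infProd (fun n => 1 - K.indicator φ (X n ω)) =
      ∏ c : φ.range, (1 - c.1) ^ (pointCount X (S c) ω).toNat := by
    have := fun c => hX.ae_finite (hS c) (hv c)
    filter_upwards [ae_all_iff.2 this] with ω hω
    simp_rw [hg]
    rw [infProd_prod _ fun c n => by split_ifs <;> simp]
    refine Finset.prod_congr rfl fun c _ => ?_
    convert! infProd_ite_pow (hω c) tsub_le_self using 2
    funext n
    simp only [mem_ofPred_eq]
    congr
  rw [lintegral_congr_ae h1, lintegral_prod_of_iIndepFun]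
  · have h2 : ∀ c : φ.range, ∫⁻ ω, (1 - c.1) ^ (pointCount X (S c) ω).toNat ∂P =
        ENNReal.ofReal (Real.exp (-(lam * (c.1 * volume (S c)).toReal))) := fun c => by
      have := hX.lintegral_pow_count hlam (hS c) (hv c) (c := 1 - c.1) tsub_le_self
      rw [ENNReal.sub_sub_cancel ENNReal.one_ne_top (hc1 c)] at this
      exact this
    simp_rw [h2]
    rw [← ENNReal.ofReal_prod_of_nonneg fun n _ => (Real.exp_pos _).le, ← Real.exp_sum,
      Finset.sum_neg_distrib, ← Finset.mul_sum, ← ENNReal.toReal_sum]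
    · congr 5
      rw [← SimpleFunc.coe_restrict _ hK, SimpleFunc.lintegral_eq_lintegral,
        SimpleFunc.restrict_lintegral _ hK]
      exact Finset.sum_coe_sort φ.range fun c => c * volume (φ ⁻¹' {c} ∩ K)
    · intro c _
      exact ENNReal.mul_ne_top ((hc1 c).trans_lt ENNReal.one_lt_top).ne (hv c).ne
  · have := (hX.iIndepFun_count hS hv hd).comp (fun c N => (1 - c.1) ^ N.toNat)
      fun c => .of_discrete
    exact this
  · intro c
    exact Measurable.comp_aemeasurable (g := fun N : ℕ∞ => (1 - c.1) ^ N.toNat) .of_discrete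
      (hX.count_law _ (hS c) (hv c)).aemeasurable

/-- The Laplace functional of a homogeneous Poisson process. -/
theorem lintegral_infProd [IsProbabilityMeasure P] (hX : IsHomogeneousPPP P lam X)
    (hlam : 0 < lam) {g : Plane → ℝ≥0∞} (hg : Measurable g) (hg1 : ∀ x, g x ≤ 1)
    (hfin : ∫⁻ x, (1 - g x) ≠ ⊤) :
    ∫⁻ ω, infProd (fun n => g (X n ω)) ∂P =
      ENNReal.ofReal (Real.exp (-(lam * (∫⁻ x, (1 - g x)).toReal))) := by
  let f : Plane → ℝ≥0∞ := fun x => 1 - g x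
  have hf : Measurable f := measurable_const.sub hg
  let K : ℕ → Set Plane := fun k => Metric.closedBall 0 k
  -- Truncating to balls gives the finite area that the simple case demands; `F k` still increases
  -- to `1 - g`, so the products of `1 - F k` decrease to the product of `g`.
  let F : ℕ → Plane → ℝ≥0∞ := fun k => (K k).indicator (SimpleFunc.eapprox f k)
  have hKm : ∀ k, MeasurableSet (K k) := fun k => measurableSet_closedBall
  have hF : ∀ k, Measurable (F k) := fun k => (SimpleFunc.measurable _).indicator (hKm k)
  have hmono : ∀ x, Monotone fun k => F k x := by
    intro x k l hkl
    by_cases hx : x ∈ K k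
    · have hx' : x ∈ K l := Metric.closedBall_subset_closedBall (by exact_mod_cast hkl) hx
      simp only [F, hx, hx', indicator_of_mem]
      exact SimpleFunc.monotone_eapprox f hkl x
    · simp only [F, hx, not_false_eq_true, indicator_of_notMem, zero_le]
  have happ : ∀ k x, SimpleFunc.eapprox f k x ≤ f x := fun k x => by
    rw [← SimpleFunc.iSup_eapprox_apply hf x]
    exact le_iSup (fun k => SimpleFunc.eapprox f k x) k
  have hFf : ∀ x, Filter.Tendsto (fun k => F k x) Filter.atTop (𝓝 (f x)) := by
    intro x
    refine (SimpleFunc.tendsto_eapprox hf x).congr' ?_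
    obtain ⟨m, hm⟩ := exists_nat_ge ‖x‖
    filter_upwards [Filter.eventually_ge_atTop m] with k hk
    have : x ∈ K k := by
      simp only [K, Metric.mem_closedBall, dist_zero_right]
      exact hm.trans (by exact_mod_cast hk)
    simp [F, this]
  have hsup : ∀ x, ⨆ k, F k x = f x := fun x =>
    tendsto_nhds_unique (tendsto_atTop_iSup (hmono x)) (hFf x)
  have hk : ∀ k, ∫⁻ ω, infProd (fun n => 1 - F k (X n ω)) ∂P =
      ENNReal.ofReal (Real.exp (-(lam * (∫⁻ x, F k x).toReal))) := fun k =>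
    hX.lintegral_infProd_simple hlam _ (fun x => (happ k x).trans tsub_le_self) (hKm k)
      measure_closedBall_lt_top
  have hL : ∫⁻ ω, infProd (fun n => g (X n ω)) ∂P =
      ⨅ k, ∫⁻ ω, infProd (fun n => 1 - F k (X n ω)) ∂P := by
    rw [← MeasureTheory.lintegral_iInf]
    · refine lintegral_congr fun ω => ?_
      rw [← infProd_iInf (a := fun k n => 1 - F k (X n ω)) (fun k n => tsub_le_self) fun n k l hkl => tsub_le_tsub_left (hmono _ hkl) _]
      congr 1
      ext n
      rw [← ENNReal.sub_iSup ENNReal.one_ne_top, hsup,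
        ENNReal.sub_sub_cancel ENNReal.one_ne_top (hg1 _)]
    · exact fun k => measurable_infProd (a := fun n ω => 1 - F k (X n ω)) fun n =>
        measurable_const.sub ((hF k).comp (hX.measurable_point n))
    · exact fun k l hkl ω => infProd_mono fun n => tsub_le_tsub_left (hmono _ hkl) _
    · refine ne_top_of_le_ne_top (b := ∫⁻ _, 1 ∂P) (by simp) (lintegral_mono fun ω => ?_)
      exact infProd_le_one _
  rw [hL]
  refine tendsto_nhds_unique (tendsto_atTop_iInf fun k l hkl => lintegral_mono fun ω =>
    infProd_mono fun n => tsub_le_tsub_left (hmono _ hkl) _) ?_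
  simp_rw [hk]
  refine ENNReal.tendsto_ofReal ((Real.continuous_exp.tendsto _).comp
    (Filter.Tendsto.neg (Filter.Tendsto.const_mul _ ?_)))
  refine (ENNReal.tendsto_toReal hfin).comp ?_
  exact lintegral_tendsto_of_tendsto_of_monotone (fun k => (hF k).aemeasurable)
    (ae_of_all _ hmono) (ae_of_all _ hFf)

end IsHomogeneousPPP
end D2DCaching

/-! ### The process beyond the distance to its closest point. -/

namespace D2DCaching

open Classical in
/-- The function equal to `1` on the closed ball of radius `r` around `c`, and to `g` outside. -/
noncomputable def cutOff (c : Plane) (g : Plane → ℝ≥0∞) (r : ℝ) (y : Plane) : ℝ≥0∞ :=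
  if y ∈ Metric.closedBall c r then 1 else g y

lemma cutOff_le_one {c : Plane} {g : Plane → ℝ≥0∞} (hg : ∀ x, g x ≤ 1) (r : ℝ) (y : Plane) :
    cutOff c g r y ≤ 1 := by
  unfold cutOff; split_ifs; exacts [le_rfl, hg y]

lemma le_cutOff {c : Plane} {g : Plane → ℝ≥0∞} (hg : ∀ x, g x ≤ 1) (r : ℝ) (y : Plane) :
    g y ≤ cutOff c g r y := by
  unfold cutOff; split_ifs; exacts [hg y, le_rfl]

lemma measurable_cutOff {c : Plane} {g : Plane → ℝ≥0∞} (hg : Measurable g) (r : ℝ) :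
    Measurable (cutOff c g r) := by
  classical
  exact Measurable.ite measurableSet_closedBall measurable_const hg

lemma measurable_cutOff_uncurry {c : Plane} {g : Plane → ℝ≥0∞} (hg : Measurable g) :
    Measurable fun z : ℝ × Plane => cutOff c g z.1 z.2 := by
  classical
  simp only [cutOff, Metric.mem_closedBall]
  exact Measurable.ite (measurableSet_le (measurable_snd.dist measurable_const) measurable_fst)
    measurable_const (hg.comp measurable_snd)

lemma cutOff_mono {c : Plane} {g : Plane → ℝ≥0∞} (hg : ∀ x, g x ≤ 1) (y : Plane) :
    Monotone fun r => cutOff c g r y := by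
  intro r r' h
  by_cases hy : y ∈ Metric.closedBall c r
  · have hy' := Metric.closedBall_subset_closedBall h hy
    simp only [cutOff, hy, hy', if_true, le_refl]
  · simp only [cutOff, hy, if_false]
    exact le_cutOff hg r' y

/-- Right-continuity in the radius: a point outside a closed ball is also outside all slightly
larger ones. With open balls this would fail on the sphere. -/
lemma iInf_cutOff {c : Plane} {g : Plane → ℝ≥0∞} (hg : ∀ x, g x ≤ 1) (r : ℝ) (y : Plane) :
    ⨅ k : ℕ, cutOff c g (r + 1 / ((k : ℝ) + 1)) y = cutOff c g r y := by
  refine le_antisymm ?_ (le_iInf fun k => cutOff_mono hg y (by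
    have : (0 : ℝ) < 1 / ((k : ℝ) + 1) := by positivity
    linarith))
  by_cases hy : y ∈ Metric.closedBall c r
  · simp only [cutOff, hy, if_true]
    exact (iInf_le _ 0).trans (cutOff_le_one hg _ _)
  · have hd : r < dist y c := by simpa using hy
    obtain ⟨k, hk⟩ := exists_nat_one_div_lt (sub_pos.2 hd)
    refine (iInf_le _ k).trans ?_
    have : y ∉ Metric.closedBall c (r + 1 / ((k : ℝ) + 1)) := by
      rw [Metric.mem_closedBall, not_le]; linarith
    simp only [cutOff, hy, this, if_false, le_refl]

lemma monotone_infProd_cutOff {c : Plane} {g : Plane → ℝ≥0∞} (hg : ∀ x, g x ≤ 1) (x : ℕ → Plane) :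
    Monotone fun r => infProd fun n => cutOff c g r (x n) :=
  fun _ _ h => infProd_mono fun n => cutOff_mono hg (x n) h

lemma tendsto_infProd_cutOff {c : Plane} {g : Plane → ℝ≥0∞} (hg : ∀ x, g x ≤ 1) (x : ℕ → Plane)
    {r : ℝ} {ρ : ℕ → ℝ} (hρ : ∀ j, r ≤ ρ j) (hlim : Tendsto ρ atTop (𝓝 r)) :
    Tendsto (fun j => infProd fun n => cutOff c g (ρ j) (x n)) atTop
      (𝓝 (infProd fun n => cutOff c g r (x n))) := by
  have hinf : infProd (fun n => cutOff c g r (x n)) =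
      ⨅ k : ℕ, infProd fun n => cutOff c g (r + 1 / ((k : ℝ) + 1)) (x n) := by
    rw [← infProd_iInf (a := fun k n => cutOff c g (r + 1 / ((k : ℝ) + 1)) (x n))
      (fun k n => cutOff_le_one hg _ _)]
    · simp_rw [iInf_cutOff hg]
    · intro n k l hkl
      refine cutOff_mono hg _ ?_
      gcongr
  refine tendsto_order.2 ⟨fun b hb => Eventually.of_forall fun j =>
    hb.trans_le (monotone_infProd_cutOff hg x (hρ j)), fun b hb => ?_⟩
  rw [hinf, gt_iff_lt, iInf_lt_iff] at hb
  obtain ⟨k, hk⟩ := hb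
  have hpos : (0 : ℝ) < 1 / ((k : ℝ) + 1) := by positivity
  filter_upwards [hlim.eventually (Iio_mem_nhds (show r < r + 1 / ((k : ℝ) + 1) by linarith))]
    with j hj
  exact (monotone_infProd_cutOff hg x (mem_Iio.1 hj).le).trans_lt hk

variable {Ω : Type*} [MeasurableSpace Ω] {P : Measure Ω} {lam : ℝ} {X : ℕ → Ω → Plane}

/-- The distance from `c` to the closest point of a sequence. -/
noncomputable def minDist (c : Plane) (x : ℕ → Plane) : ℝ := ⨅ n, dist c (x n)

lemma bddBelow_dist (c : Plane) (x : ℕ → Plane) : BddBelow (range fun n => dist c (x n)) :=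
  ⟨0, by rintro _ ⟨n, rfl⟩; exact dist_nonneg⟩

lemma minDist_nonneg (c : Plane) (x : ℕ → Plane) : 0 ≤ minDist c x :=
  Real.iInf_nonneg fun _ => dist_nonneg

lemma measurable_minDist (c : Plane) : Measurable (minDist c) :=
  Measurable.iInf fun n => measurable_const.dist (measurable_pi_apply n)

lemma le_minDist_iff {c : Plane} {x : ℕ → Plane} {a : ℝ} :
    a ≤ minDist c x ↔ ∀ n, a ≤ dist c (x n) :=
  le_ciInf_iff (bddBelow_dist c x)

/-- The mean of the infinite product of `g` over the points at distance more than `r` from `c`. -/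
noncomputable def outerMean (P : Measure Ω) (X : ℕ → Ω → Plane) (c : Plane) (g : Plane → ℝ≥0∞)
    (r : ℝ) : ℝ≥0∞ := ∫⁻ ω, infProd (fun n => cutOff c g r (X n ω)) ∂P

lemma monotone_outerMean {c : Plane} {g : Plane → ℝ≥0∞} (hg : ∀ x, g x ≤ 1) :
    Monotone (outerMean P X c g) :=
  fun _ _ h => lintegral_mono fun _ => monotone_infProd_cutOff hg _ h

lemma outerMean_le_one [IsProbabilityMeasure P] (c : Plane) (g : Plane → ℝ≥0∞) (r : ℝ) :
    outerMean P X c g r ≤ 1 :=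
  (lintegral_mono fun _ => infProd_le_one _).trans (by simp)

namespace IsHomogeneousPPP

lemma measurable_minDist (hX : IsHomogeneousPPP P lam X) (c : Plane) :
    Measurable fun ω => minDist c fun n => X n ω :=
  (D2DCaching.measurable_minDist c).comp (measurable_pi_lambda _ hX.measurable_point)

lemma measurable_infProd_cutOff (hX : IsHomogeneousPPP P lam X) (c : Plane) {g : Plane → ℝ≥0∞}
    (hg : Measurable g) {ρ : Ω → ℝ} (hρ : Measurable ρ) :
    Measurable fun ω => infProd fun n => cutOff c g (ρ ω) (X n ω) := by
  have h := fun n => (measurable_cutOff_uncurry (c := c) hg).comp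
    (hρ.prodMk (hX.measurable_point n))
  exact measurable_infProd h

lemma tendsto_outerMean [IsProbabilityMeasure P] (hX : IsHomogeneousPPP P lam X) {c : Plane}
    {g : Plane → ℝ≥0∞} (hgm : Measurable g)
    (hg : ∀ x, g x ≤ 1) {r : ℝ} {ρ : ℕ → ℝ} (hρ : ∀ j, r ≤ ρ j) (hlim : Tendsto ρ atTop (𝓝 r)) :
    Tendsto (fun j => outerMean P X c g (ρ j)) atTop (𝓝 (outerMean P X c g r)) := by
  refine tendsto_lintegral_of_dominated_convergence (fun _ => 1)
    (fun j => hX.measurable_infProd_cutOff c hgm measurable_const)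
    (fun j => ae_of_all _ fun ω => infProd_le_one _) (by simp)
    (ae_of_all _ fun ω => tendsto_infProd_cutOff hg _ hρ hlim)

lemma outerMean_eq [IsProbabilityMeasure P] (hX : IsHomogeneousPPP P lam X) (hlam : 0 < lam)
    {c : Plane} {g : Plane → ℝ≥0∞} (hgm : Measurable g)
    (hg : ∀ x, g x ≤ 1) (hfin : ∫⁻ x, (1 - g x) ≠ ⊤) (r : ℝ) :
    outerMean P X c g r =
      ENNReal.ofReal (Real.exp (-(lam * (∫⁻ x, (1 - cutOff c g r x)).toReal))) :=
  hX.lintegral_infProd hlam (measurable_cutOff hgm r) (cutOff_le_one hg r)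
    (ne_top_of_le_ne_top hfin (lintegral_mono fun x => tsub_le_tsub_left (le_cutOff hg r x) _))

-- The event says that the open ball of radius `a` is empty, so its indicator is itself a product
-- over the points, of a function `u`. As `a ≤ r`, the functions `1 - u` and `1 - cutOff c g r` have
-- disjoint supports; the exponents in the Laplace functional add, and the mean factorises.
open Classical in
lemma setLIntegral_infProd_cutOff [IsProbabilityMeasure P] (hX : IsHomogeneousPPP P lam X)
    (hlam : 0 < lam)
    {c : Plane} {g : Plane → ℝ≥0∞} (hgm : Measurable g) (hg : ∀ x, g x ≤ 1)
    (hfin : ∫⁻ x, (1 - g x) ≠ ⊤) {a r : ℝ} (har : a ≤ r) :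
    ∫⁻ ω in {ω | a ≤ minDist c fun n => X n ω}, infProd (fun n => cutOff c g r (X n ω)) ∂P =
      P {ω | a ≤ minDist c fun n => X n ω} * outerMean P X c g r := by
  have hS : MeasurableSet {ω | a ≤ minDist c fun n => X n ω} :=
    measurableSet_le measurable_const (hX.measurable_minDist c)
  let u : Plane → ℝ≥0∞ := fun y => if a ≤ dist c y then 1 else 0
  have hu : Measurable u := Measurable.ite (measurableSet_le (by fun_prop) (by fun_prop))
    measurable_const measurable_const
  have hu1 : ∀ y, u y ≤ 1 := fun y => by simp only [u]; split_ifs <;> simp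
  have hind : ∀ ω, infProd (fun n => u (X n ω)) =
      {ω | a ≤ minDist c fun n => X n ω}.indicator 1 ω := fun ω => by
    rw [infProd_indicator]
    simp [indicator, le_minDist_iff]
  have hball : ∫⁻ y, (1 - u y) ≠ ⊤ := by
    have : ∀ y, 1 - u y = (Metric.ball c a).indicator 1 y := fun y => by
      simp only [u, indicator, Metric.mem_ball, dist_comm y c]
      by_cases h : a ≤ dist c y
      · simp [h]
      · simp [h, not_le.1 h]
    simp_rw [this]
    rw [lintegral_indicator_one measurableSet_ball]
    exact measure_ball_lt_top.ne
  have hP : P {ω | a ≤ minDist c fun n => X n ω} =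
      ENNReal.ofReal (Real.exp (-(lam * (∫⁻ y, (1 - u y)).toReal))) := by
    rw [← hX.lintegral_infProd hlam hu hu1 hball]
    simp_rw [hind]
    rw [lintegral_indicator_one hS]
  have hsub : ∀ y, 1 - u y * cutOff c g r y = (1 - u y) + (1 - cutOff c g r y) := fun y => by
    by_cases h : a ≤ dist c y
    · simp [u, h]
    · have : y ∈ Metric.closedBall c r := by
        rw [Metric.mem_closedBall, dist_comm]; linarith
      simp [u, h, cutOff, this]
  have hcut : ∫⁻ x, (1 - cutOff c g r x) ≠ ⊤ :=
    ne_top_of_le_ne_top hfin (lintegral_mono fun x => tsub_le_tsub_left (le_cutOff hg r x) _)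
  have hadd : ∫⁻ y, (1 - u y * cutOff c g r y) =
      (∫⁻ y, (1 - u y)) + ∫⁻ y, (1 - cutOff c g r y) := by
    simp_rw [hsub]
    have hm : Measurable fun y => 1 - u y := measurable_const.sub hu
    exact lintegral_add_left hm _
  calc ∫⁻ ω in {ω | a ≤ minDist c fun n => X n ω}, infProd (fun n => cutOff c g r (X n ω)) ∂P
      = ∫⁻ ω, infProd (fun n => u (X n ω) * cutOff c g r (X n ω)) ∂P := by
        rw [← lintegral_indicator hS]
        refine lintegral_congr fun ω => ?_
        rw [infProd_mul (fun n => hu1 _) (fun n => cutOff_le_one hg _ _), hind]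
        simp [indicator]
    _ = _ := by
        rw [hX.lintegral_infProd (g := fun y => u y * cutOff c g r y) hlam (hu.mul (measurable_cutOff hgm r))
          (fun y => mul_le_one' (hu1 y) (cutOff_le_one hg r y))
          (by rw [hadd]; exact ENNReal.add_ne_top.2 ⟨hball, hcut⟩), hP,
          hX.outerMean_eq hlam hgm hg hfin, hadd, ENNReal.toReal_add hball hcut,
          ← ENNReal.ofReal_mul (Real.exp_pos _).le, ← Real.exp_add]
        congr 2
        ring

/-- Difference of the preceding factorisation for the events with thresholds `a` and `b`, both at
the cut-off radius `b`. Finiteness permits the cancellation. -/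
lemma setLIntegral_infProd_cutOff_Ico [IsProbabilityMeasure P] (hX : IsHomogeneousPPP P lam X)
    (hlam : 0 < lam)
    {c : Plane} {g : Plane → ℝ≥0∞} (hgm : Measurable g) (hg : ∀ x, g x ≤ 1)
    (hfin : ∫⁻ x, (1 - g x) ≠ ⊤) {a b : ℝ} (hab : a ≤ b) :
    ∫⁻ ω in {ω | (minDist c fun n => X n ω) ∈ Ico a b},
        infProd (fun n => cutOff c g b (X n ω)) ∂P =
      P {ω | (minDist c fun n => X n ω) ∈ Ico a b} * outerMean P X c g b := by
  have hS : ∀ a, MeasurableSet {ω | a ≤ minDist c fun n => X n ω} := fun a =>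
    measurableSet_le measurable_const (hX.measurable_minDist c)
  have hI : MeasurableSet {ω | (minDist c fun n => X n ω) ∈ Ico a b} :=
    hX.measurable_minDist c measurableSet_Ico
  have hun : {ω | a ≤ minDist c fun n => X n ω} =
      {ω | (minDist c fun n => X n ω) ∈ Ico a b} ∪ {ω | b ≤ minDist c fun n => X n ω} := by
    ext ω
    simp only [mem_ofPred_eq, mem_Ico, mem_union]
    constructor
    · intro h
      rcases lt_or_ge (minDist c fun n => X n ω) b with h' | h'
      exacts [Or.inl ⟨h, h'⟩, Or.inr h']
    · rintro (h | h)
      exacts [h.1, hab.trans h]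
  have hd : Disjoint {ω | (minDist c fun n => X n ω) ∈ Ico a b}
      {ω | b ≤ minDist c fun n => X n ω} :=
    Set.disjoint_left.2 fun ω h h' => absurd h.2 (not_lt.2 h')
  have h1 := hX.setLIntegral_infProd_cutOff hlam hgm hg hfin (c := c) hab
  have h2 := hX.setLIntegral_infProd_cutOff hlam hgm hg hfin (c := c) (le_refl b)
  rw [hun, lintegral_union (hS b) hd, measure_union hd (hS b), add_mul, h2] at h1
  refine (ENNReal.add_left_inj ?_).1 h1
  exact ENNReal.mul_ne_top (measure_ne_top _ _)
    ((outerMean_le_one c g b).trans_lt ENNReal.one_lt_top).ne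

/-- Given the distance from `c` to the closest point, the points farther away than this distance
are distributed like the points of an independent copy. -/
theorem setLIntegral_minDist [IsProbabilityMeasure P] (hX : IsHomogeneousPPP P lam X)
    (hlam : 0 < lam)
    {c : Plane} {g : Plane → ℝ≥0∞} (hgm : Measurable g) (hg : ∀ x, g x ≤ 1)
    (hfin : ∫⁻ x, (1 - g x) ≠ ⊤) {A : Set ℝ} (hA : MeasurableSet A) :
    ∫⁻ ω in (fun ω => minDist c fun n => X n ω) ⁻¹' A,
        infProd (fun n => cutOff c g (minDist c fun n => X n ω) (X n ω)) ∂P =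
      ∫⁻ ω in (fun ω => minDist c fun n => X n ω) ⁻¹' A,
        outerMean P X c g (minDist c fun n => X n ω) ∂P := by
  set R : Ω → ℝ := fun ω => minDist c fun n => X n ω with hRdef
  have hR : Measurable R := hX.measurable_minDist c
  have hR0 : ∀ ω, 0 ≤ R ω := fun ω => minDist_nonneg _ _
  -- The right end of the grid cell of mesh `1 / (j + 1)` that contains `R`: it takes countably many
  -- values and lies strictly above `R`, so right-continuity applies in the limit.
  let Rb : ℕ → Ω → ℝ := fun j ω => (⌊((j : ℝ) + 1) * R ω⌋₊ + 1) / ((j : ℝ) + 1)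
  have hRb : ∀ j, Measurable (Rb j) := fun j => by
    have : Measurable fun ω => ⌊((j : ℝ) + 1) * R ω⌋₊ := Nat.measurable_floor.comp (hR.const_mul _)
    exact (((measurable_from_top (f := fun n : ℕ => (n : ℝ))).comp this).add_const _).div_const _
  have hlt : ∀ j ω, R ω < Rb j ω := fun j ω => by
    rw [lt_div_iff₀ (by positivity), mul_comm]
    exact Nat.lt_floor_add_one _
  have hle : ∀ j ω, Rb j ω ≤ R ω + 1 / ((j : ℝ) + 1) := fun j ω => by
    have := Nat.floor_le (mul_nonneg (by positivity : (0 : ℝ) ≤ (j : ℝ) + 1) (hR0 ω))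
    have hj : (0 : ℝ) < (j : ℝ) + 1 := by positivity
    rw [div_le_iff₀ hj, add_mul (R ω), one_div_mul_cancel hj.ne', mul_comm (R ω)]
    linarith
  have hlim : ∀ ω, Tendsto (fun j => Rb j ω) atTop (𝓝 (R ω)) := fun ω => by
    refine tendsto_of_tendsto_of_tendsto_of_le_of_le tendsto_const_nhds ?_
      (fun j => (hlt j ω).le) (fun j => hle j ω)
    simpa using (tendsto_one_div_add_atTop_nhds_zero_nat (𝕜 := ℝ)).const_add (R ω)
  have hOM : Measurable (outerMean P X c g) := (monotone_outerMean hg).measurable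
  -- The indicator is taken of `Rb j`, not of `R`, so that on each cell both it and the cut-off
  -- radius are constant.
  have hstep : ∀ (b : ℝ) (j : ℕ),
      ∫⁻ ω, (Iio b).indicator 1 (Rb j ω) * infProd (fun n => cutOff c g (Rb j ω) (X n ω)) ∂P =
      ∫⁻ ω, (Iio b).indicator 1 (Rb j ω) * outerMean P X c g (Rb j ω) ∂P := by
    intro b j
    let E : ℕ → Set Ω := fun k => {ω | ⌊((j : ℝ) + 1) * R ω⌋₊ = k}
    have hE : ∀ k, E k = {ω | R ω ∈ Ico ((k : ℝ) / (j + 1)) (((k : ℝ) + 1) / (j + 1))} := by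
      intro k
      ext ω
      simp only [E, mem_ofPred_eq, mem_Ico]
      rw [Nat.floor_eq_iff (mul_nonneg (by positivity) (hR0 ω)), div_le_iff₀ (by positivity),
        lt_div_iff₀ (by positivity), mul_comm]
    have hEm : ∀ k, MeasurableSet (E k) := fun k => by
      rw [hE]; exact hR measurableSet_Ico
    have hU : ⋃ k, E k = univ := by
      ext ω; simp [E]
    have hdis : Pairwise (Function.onFun Disjoint E) := fun k l hkl =>
      Set.disjoint_left.2 fun ω h h' => hkl (h.symm.trans h')
    rw [← setLIntegral_univ, ← hU, lintegral_iUnion hEm hdis, ← setLIntegral_univ, ← hU,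
      lintegral_iUnion hEm hdis]
    refine tsum_congr fun k => ?_
    have hRk : ∀ ω ∈ E k, Rb j ω = ((k : ℝ) + 1) / (j + 1) := fun ω hω => by
      have : ⌊((j : ℝ) + 1) * R ω⌋₊ = k := hω
      simp only [Rb, this]
    have e₁ : ∫⁻ ω in E k, (Iio b).indicator 1 (Rb j ω) *
          infProd (fun n => cutOff c g (Rb j ω) (X n ω)) ∂P =
        ∫⁻ ω in E k, (Iio b).indicator 1 (((k : ℝ) + 1) / (j + 1)) *
          infProd (fun n => cutOff c g (((k : ℝ) + 1) / (j + 1)) (X n ω)) ∂P :=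
      setLIntegral_congr_fun (hEm k) fun ω hω => by simp only [hRk ω hω]
    have e₂ : ∫⁻ ω in E k, (Iio b).indicator 1 (Rb j ω) * outerMean P X c g (Rb j ω) ∂P =
        ∫⁻ ω in E k, (Iio b).indicator 1 (((k : ℝ) + 1) / (j + 1)) *
          outerMean P X c g (((k : ℝ) + 1) / (j + 1)) ∂P :=
      setLIntegral_congr_fun (hEm k) fun ω hω => by simp only [hRk ω hω]
    rw [e₁, e₂, lintegral_const_mul _ (hX.measurable_infProd_cutOff c hgm measurable_const),
      setLIntegral_const, hE k,
      hX.setLIntegral_infProd_cutOff_Ico hlam hgm hg hfin (by gcongr; linarith)]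
    ring
  -- Convergence holds at every point, including `R ω = b`, because `Rb j` approaches from above and
  -- `Iio b` is open.
  have hind : ∀ b ω, Tendsto (fun j => (Iio b).indicator (1 : ℝ → ℝ≥0∞) (Rb j ω)) atTop
      (𝓝 ((Iio b).indicator 1 (R ω))) := by
    intro b ω
    refine tendsto_const_nhds.congr' ?_
    by_cases h : R ω < b
    · filter_upwards [(hlim ω).eventually (Iio_mem_nhds h)] with j hj
      simp only [indicator, mem_Iio, show Rb j ω < b from hj, h, if_true, Pi.one_apply]
    · refine Eventually.of_forall fun j => ?_
      have h' : ¬ Rb j ω < b := not_lt.2 ((not_lt.1 h).trans (hlt j ω).le)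
      simp only [indicator, mem_Iio, h, h', if_false]
  have hi1 : ∀ b x, (Iio b).indicator (1 : ℝ → ℝ≥0∞) x ≤ 1 := fun b x =>
    indicator_le_self' (by simp) x
  have hi1' : ∀ b x, (Iio b).indicator (1 : ℝ → ℝ≥0∞) x ≠ ⊤ := fun b x =>
    ((hi1 b x).trans_lt ENNReal.one_lt_top).ne
  have him : ∀ b, Measurable ((Iio b).indicator (1 : ℝ → ℝ≥0∞)) := fun b =>
    measurable_one.indicator measurableSet_Iio
  have hOM1 : ∀ r, outerMean P X c g r ≠ ⊤ := fun r =>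
    ((outerMean_le_one c g r).trans_lt ENNReal.one_lt_top).ne
  have hIio : ∀ b : ℝ,
      ∫⁻ ω, (Iio b).indicator 1 (R ω) * infProd (fun n => cutOff c g (R ω) (X n ω)) ∂P =
      ∫⁻ ω, (Iio b).indicator 1 (R ω) * outerMean P X c g (R ω) ∂P := by
    intro b
    refine tendsto_nhds_unique (f := fun j : ℕ => ∫⁻ ω, (Iio b).indicator 1 (Rb j ω) *
      infProd (fun n => cutOff c g (Rb j ω) (X n ω)) ∂P) (l := atTop) ?_ ?_
    · refine tendsto_lintegral_of_dominated_convergence (fun _ => 1)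
        (fun j => ((him b).comp (hRb j)).mul (hX.measurable_infProd_cutOff c hgm (hRb j)))
        (fun j => ae_of_all _ fun ω => mul_le_one' (hi1 _ _) (infProd_le_one _)) (by simp)
        (ae_of_all _ fun ω => ENNReal.Tendsto.mul (hind b ω) (Or.inr (infProd_ne_top _))
          (tendsto_infProd_cutOff hg _ (fun j => (hlt j ω).le) (hlim ω)) (Or.inr (hi1' _ _)))
    · simp_rw [hstep b]
      refine tendsto_lintegral_of_dominated_convergence (fun _ => 1)
        (fun j => ((him b).comp (hRb j)).mul (hOM.comp (hRb j)))
        (fun j => ae_of_all _ fun ω => mul_le_one' (hi1 _ _) (outerMean_le_one _ _ _)) (by simp)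
        (ae_of_all _ fun ω => ENNReal.Tendsto.mul (hind b ω) (Or.inr (hOM1 _))
          (hX.tendsto_outerMean hgm hg (fun j => (hlt j ω).le) (hlim ω)) (Or.inr (hi1' _ _)))
  -- The two sides, as functions of the set, are finite measures on the line; they agree on the
  -- π-system of rays `Iio b` and in total mass, hence on `A`.
  let F₁ : Ω → ℝ≥0∞ := fun ω => infProd (fun n => cutOff c g (R ω) (X n ω))
  let F₂ : Ω → ℝ≥0∞ := fun ω => outerMean P X c g (R ω)
  have hset : ∀ (F : Ω → ℝ≥0∞) (B : Set ℝ), MeasurableSet B →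
      ((P.withDensity F).map R) B = ∫⁻ ω, B.indicator 1 (R ω) * F ω ∂P := by
    intro F B hB
    rw [Measure.map_apply hR hB, withDensity_apply _ (hR hB), ← lintegral_indicator (hR hB)]
    refine lintegral_congr fun ω => ?_
    by_cases h : R ω ∈ B <;> simp [indicator, h]
  have hfin1 : ∀ F : Ω → ℝ≥0∞, (∀ ω, F ω ≤ 1) → IsFiniteMeasure (P.withDensity F) := fun F hF =>
    isFiniteMeasure_withDensity (ne_top_of_le_ne_top ENNReal.one_ne_top
      ((lintegral_mono hF).trans (by simp)))
  have := hfin1 F₁ fun ω => infProd_le_one _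
  have := hfin1 F₂ fun ω => outerMean_le_one _ _ _
  have huniv : (P.withDensity F₁).map R univ = (P.withDensity F₂).map R univ := by
    have h : ∀ F : Ω → ℝ≥0∞, Tendsto (fun n : ℕ => (P.withDensity F).map R (Iio (n : ℝ))) atTop
        (𝓝 ((P.withDensity F).map R univ)) := fun F => by
      have hU : ⋃ n : ℕ, Iio (n : ℝ) = univ :=
        eq_univ_of_forall fun x => mem_iUnion.2 (exists_nat_gt x)
      rw [← hU]
      exact tendsto_measure_iUnion_atTop fun a b hab => Iio_subset_Iio (by exact_mod_cast hab)
    refine tendsto_nhds_unique ((h F₁).congr fun n => ?_) (h F₂)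
    rw [hset _ _ measurableSet_Iio, hset _ _ measurableSet_Iio]
    exact hIio n
  have hmeas : (P.withDensity F₁).map R = (P.withDensity F₂).map R := by
    refine ext_of_generate_finite (range Iio) (borel_eq_generateFrom_Iio ℝ ▸
      BorelSpace.measurable_eq) isPiSystem_Iio ?_ huniv
    rintro _ ⟨b, rfl⟩
    rw [hset _ _ measurableSet_Iio, hset _ _ measurableSet_Iio]
    exact hIio b
  have := congrArg (fun μ => μ A) hmeas
  simp only [Measure.map_apply hR hA, withDensity_apply _ (hR hA)] at this
  exact this

end IsHomogeneousPPP
end D2DCaching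

/-! ### Uniqueness and existence of the closest point. -/

namespace D2DCaching

variable {Ω : Type*} [MeasurableSpace Ω] {P : Measure Ω} {lam : ℝ} {X : ℕ → Ω → Plane}

/-- The half-open annulus around `c` with squared radii `a` and `b`. -/
def annulus (c : Plane) (a b : ℝ) : Set Plane := {y | dist c y ^ 2 ∈ Ico a b}

lemma measurableSet_annulus (c : Plane) (a b : ℝ) : MeasurableSet (annulus c a b) :=
  measurableSet_Ico.preimage ((measurable_const.dist measurable_id).pow_const 2)

lemma volume_annulus (c : Plane) {a b : ℝ} (ha : 0 ≤ a) (hab : a ≤ b) :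
    volume (annulus c a b) = ENNReal.ofReal (Real.pi * (b - a)) := by
  have hs : ∀ {b : ℝ}, 0 ≤ b → ∀ y, y ∈ Metric.ball c (√b) ↔ dist c y ^ 2 < b := fun hb y => by
    rw [Metric.mem_ball, dist_comm, Real.lt_sqrt dist_nonneg]
  have h : annulus c a b = Metric.ball c (√b) \ Metric.ball c (√a) := by
    ext y
    rw [Set.mem_sdiff, hs (ha.trans hab), hs ha, not_lt]
    exact and_comm
  rw [h, measure_sdiff (Metric.ball_subset_ball (Real.sqrt_le_sqrt hab))
    measurableSet_ball.nullMeasurableSet measure_ball_lt_top.ne,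
    EuclideanSpace.volume_ball_fin_two, EuclideanSpace.volume_ball_fin_two,
    ← ENNReal.ofReal_pow (Real.sqrt_nonneg _), ← ENNReal.ofReal_pow (Real.sqrt_nonneg _),
    Real.sq_sqrt ha, Real.sq_sqrt (ha.trans hab)]
  rw [← ENNReal.ofReal_mul (ha.trans hab), ← ENNReal.ofReal_mul ha,
    ← ENNReal.ofReal_sub _ (mul_nonneg ha Real.pi_pos.le)]
  congr 1
  ring

namespace IsHomogeneousPPP

lemma ae_locally_finite (hX : IsHomogeneousPPP P lam X) (c : Plane) :
    ∀ᵐ ω ∂P, ∀ r : ℝ, {n | X n ω ∈ Metric.closedBall c r}.Finite := by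
  have := ae_all_iff.2 fun k : ℕ =>
    hX.ae_finite (S := Metric.closedBall c k) measurableSet_closedBall measure_closedBall_lt_top
  filter_upwards [this] with ω hω r
  obtain ⟨k, hk⟩ := exists_nat_ge r
  exact (hω k).subset fun n hn => Metric.closedBall_subset_closedBall hk hn

lemma ae_ne (hX : IsHomogeneousPPP P lam X) (c : Plane) : ∀ᵐ ω ∂P, ∀ n, X n ω ≠ c := by
  refine ae_all_iff.2 fun n => ?_
  have h : Measure.sum (fun n => P.map (X n)) {c} = 0 := by
    rw [hX.sum_map_eq]; simp
  rw [Measure.sum_apply _ (measurableSet_singleton c), ENNReal.tsum_eq_zero] at h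
  have := h n
  rw [Measure.map_apply (hX.measurable_point n) (measurableSet_singleton c)] at this
  exact measure_eq_zero_iff_ae_notMem.1 this

/-- Equidistant points share every annulus around `c` that contains one of them. Cutting the disc of
squared radius `K` at equally spaced squared radii gives `K * (j + 1)` annuli of equal area `π / (j
+ 1)`. Each holds two points with probability at most `(lam * π / (j + 1)) ^ 2`, so the union bound
is of order `1 / (j + 1)` and tends to `0`. -/
lemma ae_dist_injective (hX : IsHomogeneousPPP P lam X) (hlam : 0 < lam) (c : Plane) :
    ∀ᵐ ω ∂P, Function.Injective fun n => dist c (X n ω) := by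
  have key : ∀ K : ℕ, P {ω | ∃ n m, n ≠ m ∧ dist c (X n ω) = dist c (X m ω) ∧
      dist c (X n ω) ^ 2 < K} = 0 := by
    intro K
    have hbound : ∀ j : ℕ, P {ω | ∃ n m, n ≠ m ∧ dist c (X n ω) = dist c (X m ω) ∧
        dist c (X n ω) ^ 2 < K} ≤ ENNReal.ofReal (K * (lam * Real.pi) ^ 2 * (1 / ((j : ℝ) + 1))) := by
      intro j
      let S : ℕ → Set Plane := fun i =>
        annulus c ((i : ℝ) / ((j : ℝ) + 1)) (((i : ℝ) + 1) / ((j : ℝ) + 1))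
      have hj : (0 : ℝ) < (j : ℝ) + 1 := by positivity
      have hvol : ∀ i, volume (S i) = ENNReal.ofReal (Real.pi / ((j : ℝ) + 1)) := fun i => by
        rw [volume_annulus c (by positivity) (by gcongr; linarith)]
        congr 1
        field_simp
        ring
      have hsub : {ω | ∃ n m, n ≠ m ∧ dist c (X n ω) = dist c (X m ω) ∧
          dist c (X n ω) ^ 2 < K} ⊆
          ⋃ i ∈ Finset.range (K * (j + 1)), {ω | 2 ≤ pointCount X (S i) ω} := by
        rintro ω ⟨n, m, hnm, hd, hlt⟩
        have h0 : 0 ≤ dist c (X n ω) ^ 2 * ((j : ℝ) + 1) := by positivity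
        have h1 := Nat.floor_le h0
        have h2 := Nat.lt_floor_add_one (dist c (X n ω) ^ 2 * ((j : ℝ) + 1))
        set i := ⌊dist c (X n ω) ^ 2 * ((j : ℝ) + 1)⌋₊ with hi
        have hn : X n ω ∈ S i := ⟨by rwa [div_le_iff₀ hj], by rwa [lt_div_iff₀ hj]⟩
        have hm : X m ω ∈ S i := by
          have : dist c (X n ω) ^ 2 ∈ Ico _ _ := hn
          rw [hd] at this
          exact this
        refine mem_biUnion (x := i) ?_ ?_
        · rw [SetLike.mem_coe, Finset.mem_range, hi, Nat.floor_lt h0]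
          push_cast
          gcongr
        · have : 1 < {n | X n ω ∈ S i}.encard := Set.one_lt_encard_iff.2 ⟨n, m, hn, hm, hnm⟩
          exact Order.add_one_le_of_lt this
      refine (measure_mono hsub).trans ((measure_biUnion_finset_le _ _).trans ?_)
      have hle : ∀ i ∈ Finset.range (K * (j + 1)), P {ω | 2 ≤ pointCount X (S i) ω} ≤
          ENNReal.ofReal ((lam * (Real.pi / ((j : ℝ) + 1))) ^ 2) := fun i _ => by
        refine (hX.measure_two_le_count hlam (measurableSet_annulus _ _ _)
          (by rw [hvol]; exact ENNReal.ofReal_lt_top)).trans ?_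
        rw [hvol, ENNReal.toReal_ofReal (by positivity)]
      refine (Finset.sum_le_sum hle).trans ?_
      rw [Finset.sum_const, Finset.card_range, nsmul_eq_mul, ← ENNReal.ofReal_natCast,
        ← ENNReal.ofReal_mul (by positivity)]
      refine ENNReal.ofReal_le_ofReal (le_of_eq ?_)
      push_cast
      field_simp
    have := ENNReal.tendsto_ofReal ((tendsto_one_div_add_atTop_nhds_zero_nat (𝕜 := ℝ)).const_mul
      ((K : ℝ) * (lam * Real.pi) ^ 2))
    simp only [mul_zero, ENNReal.ofReal_zero] at this
    exact le_antisymm (ge_of_tendsto' this hbound) bot_le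
  have := ae_all_iff.2 fun K : ℕ => measure_eq_zero_iff_ae_notMem.1 (key K)
  filter_upwards [this] with ω hω n m hnm
  by_contra hne
  obtain ⟨K, hK⟩ := exists_nat_gt (dist c (X n ω) ^ 2)
  exact hω K ⟨n, m, hne, hnm, hK⟩

end IsHomogeneousPPP

lemma exists_dist_eq_minDist {c : Plane} {x : ℕ → Plane}
    (hx : ∀ r : ℝ, {n | x n ∈ Metric.closedBall c r}.Finite) :
    ∃ n, dist c (x n) = minDist c x := by
  have hfin := hx (dist c (x 0))
  have hne : {n | x n ∈ Metric.closedBall c (dist c (x 0))}.Nonempty :=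
    ⟨0, by simp [dist_comm]⟩
  obtain ⟨n, hn, hmin⟩ := hfin.exists_minimalFor (fun n => dist c (x n)) _ hne
  refine ⟨n, le_antisymm (le_minDist_iff.2 fun m => ?_) (ciInf_le (bddBelow_dist c x) n)⟩
  by_contra! hlt
  have hn' : dist c (x n) ≤ dist c (x 0) := by
    rw [dist_comm]; exact hn
  have hm : x m ∈ Metric.closedBall c (dist c (x 0)) := by
    rw [Metric.mem_closedBall, dist_comm]; exact hlt.le.trans hn'
  exact absurd (hmin hm hlt.le) (not_le.2 hlt)

end D2DCaching

/-! ### Marks: averaging them and separating the mark of the closest device. -/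

namespace D2DCaching

/-- The marks: cached file portion, activity indicator and fading power. -/
abbrev Mark : Type := FilePortion × ℝ × ℝ

instance : MeasurableSingletonClass FilePortion := ⟨fun _ => trivial⟩

/-- The law of a mark. -/
noncomputable def markLaw (p q : unitInterval) : Measure Mark :=
  (bernoulliMeasure FilePortion.A FilePortion.B p).prod
    ((bernoulliMeasure (1 : ℝ) 0 q).prod (expMeasure 1))

instance : IsProbabilityMeasure (expMeasure 1) := isProbabilityMeasure_expMeasure one_pos

instance (p q : unitInterval) : IsProbabilityMeasure (markLaw p q) := by
  unfold markLaw; infer_instance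

lemma lintegral_bernoulliMeasure {E : Type*} [MeasurableSpace E] [MeasurableSingletonClass E]
    (x y : E) (p : unitInterval) (f : E → ℝ≥0∞) :
    ∫⁻ e, f e ∂(bernoulliMeasure x y p) =
      ENNReal.ofReal p * f x + ENNReal.ofReal (1 - p) * f y := by
  rw [bernoulliMeasure_def, lintegral_add_measure, lintegral_smul_measure, lintegral_smul_measure,
    lintegral_dirac, lintegral_dirac]
  simp only [ENNReal.smul_def, smul_eq_mul]
  congr 2
  · rw [← ENNReal.ofReal_coe_nnreal]; simp
  · rw [← ENNReal.ofReal_coe_nnreal]; simp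

lemma lintegral_expMeasure_one (F : ℝ → ℝ≥0∞) :
    ∫⁻ x, F x ∂(expMeasure 1) = ∫⁻ x in Ioi 0, ENNReal.ofReal (Real.exp (-x)) * F x := by
  rw [expMeasure, gammaMeasure, lintegral_withDensity_eq_lintegral_mul_non_measurable₀ _
    (f := gammaPDF 1 1) (measurable_gammaPDFReal 1 1).ennreal_ofReal.aemeasurable
    (ae_of_all _ fun x => ENNReal.ofReal_lt_top), ← lintegral_indicator measurableSet_Ioi]
  refine lintegral_congr_ae ?_
  filter_upwards [compl_mem_ae_iff.2 (measure_singleton (0 : ℝ))] with x hx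
  rcases lt_or_gt_of_ne (show x ≠ 0 from hx) with h | h
  · simp [gammaPDF_of_neg h, h.le]
  · simp [gammaPDF_of_nonneg h.le, h]

/-- The absolute value changes nothing almost surely, but it keeps the factors at most `1` for every
mark, as the infinite products require. -/
lemma lintegral_exp_neg_mul_expMeasure {a : ℝ} (ha : 0 ≤ a) :
    ∫⁻ x, ENNReal.ofReal (Real.exp (-(a * |x|))) ∂(expMeasure 1) = ENNReal.ofReal (1 / (1 + a)) := by
  rw [lintegral_expMeasure_one]
  have h : ∀ x ∈ Ioi (0 : ℝ), ENNReal.ofReal (Real.exp (-x)) * ENNReal.ofReal (Real.exp (-(a * |x|)))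
      = ENNReal.ofReal (Real.exp (-(1 + a) * x)) := fun x hx => by
    rw [← ENNReal.ofReal_mul (Real.exp_pos _).le, ← Real.exp_add, abs_of_pos hx]
    ring_nf
  rw [setLIntegral_congr_fun measurableSet_Ioi h, ← ofReal_integral_eq_lintegral_ofReal
    (integrableOn_exp_mul_Ioi (by linarith) 0) (ae_of_all _ fun x => (Real.exp_pos _).le),
    integral_exp_mul_Ioi (by linarith)]
  simp only [mul_zero, Real.exp_zero]
  congr 1
  have : (1 + a) ≠ 0 := by positivity
  field_simp

lemma lintegral_abs_expMeasure_ne_top : ∫⁻ x, ENNReal.ofReal |x| ∂(expMeasure 1) ≠ ⊤ := by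
  rw [lintegral_expMeasure_one]
  have h : ∀ x ∈ Ioi (0 : ℝ), ENNReal.ofReal (Real.exp (-x)) * ENNReal.ofReal |x|
      = ENNReal.ofReal (Real.exp (-x) * x ^ ((2 : ℝ) - 1)) := fun x hx => by
    rw [← ENNReal.ofReal_mul (Real.exp_pos _).le, abs_of_pos hx]
    norm_num
  rw [setLIntegral_congr_fun measurableSet_Ioi h]
  exact (Real.GammaIntegral_convergent (s := 2) (by norm_num)).lintegral_lt_top.ne

open Classical in
/-- The factor `exp (-s t h ‖y‖ ^ (-α))` that a device at `y` which caches file B contributes to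
the Laplace transform. -/
noncomputable def weight (s α : ℝ) (y : Plane) (m : Mark) : ℝ≥0∞ :=
  if m.1 = FilePortion.B then
    ENNReal.ofReal (Real.exp (-(s * (|m.2.1 * m.2.2| * ‖y‖ ^ (-α))))) else 1

lemma weight_le_one {s : ℝ} (hs : 0 ≤ s) (α : ℝ) (y : Plane) (m : Mark) : weight s α y m ≤ 1 := by
  unfold weight
  split_ifs
  · rw [ENNReal.ofReal_le_one, Real.exp_le_one_iff, neg_nonpos]
    positivity
  · exact le_rfl

lemma cutOff_weight_le_one {s : ℝ} (hs : 0 ≤ s) (α : ℝ) (c : Plane) (m : Mark) (r : ℝ) (y : Plane) :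
    cutOff c (fun y => weight s α y m) r y ≤ 1 :=
  cutOff_le_one (g := fun y => weight s α y m) (fun y => weight_le_one hs α y m) r y

lemma measurable_weight (s α : ℝ) : Measurable fun z : Plane × Mark => weight s α z.1 z.2 := by
  classical
  unfold weight
  refine Measurable.ite ?_ ?_ measurable_const
  · exact (measurable_snd.fst) (measurableSet_singleton FilePortion.B)
  · fun_prop

/-- The mean of the factor of a device at `y`. -/
noncomputable def meanWeight (p q : unitInterval) (s α : ℝ) (y : Plane) : ℝ≥0∞ :=
  ∫⁻ m, weight s α y m ∂(markLaw p q)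

lemma meanWeight_le_one (p q : unitInterval) {s : ℝ} (hs : 0 ≤ s) (α : ℝ) (y : Plane) :
    meanWeight p q s α y ≤ 1 :=
  (lintegral_mono fun m => weight_le_one hs α y m).trans (by simp)

lemma measurable_meanWeight (p q : unitInterval) (s α : ℝ) : Measurable (meanWeight p q s α) :=
  (measurable_weight s α).lintegral_prod_right'

/-- Only a device with portion B and indicator `1` has a factor other than `1`; its mean over the
fading is `1 / (1 + s * ‖y‖ ^ (-α))`. The origin is excluded because there Lean's `0 ^ (-α)` is `0`
for `α ≠ 0`, in place of an infinite gain. -/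
lemma one_sub_meanWeight (p q : unitInterval) {s α : ℝ} (hs : 0 < s) {y : Plane} (hy : y ≠ 0) :
    1 - meanWeight p q s α y = ENNReal.ofReal ((1 - p) * q * (1 / (1 + ‖y‖ ^ α / s))) := by
  have hm : Measurable fun m => weight s α y m := (measurable_weight s α).comp measurable_prodMk_left
  have hmf : ∀ f : FilePortion, Measurable fun z : ℝ × ℝ => weight s α y (f, z) := fun f =>
    hm.comp measurable_prodMk_left
  have hpos : 0 < ‖y‖ ^ α := Real.rpow_pos_of_pos (norm_pos_iff.2 hy) _
  have hp := p.2
  have hq := q.2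
  have hexp : ∀ x : ℝ, weight s α y (FilePortion.B, 1, x) =
      ENNReal.ofReal (Real.exp (-(s * ‖y‖ ^ (-α) * |x|))) := fun x => by
    simp only [weight, if_true, one_mul]
    congr 3
    ring
  have hA : ∀ m : ℝ × ℝ, weight s α y (FilePortion.A, m) = 1 := fun m => by simp [weight]
  have h0 : ∀ x : ℝ, weight s α y (FilePortion.B, 0, x) = 1 := fun x => by simp [weight]
  rw [meanWeight, markLaw, lintegral_prod _ hm.aemeasurable, lintegral_bernoulliMeasure,
    lintegral_prod _ (hmf _).aemeasurable, lintegral_prod _ (hmf _).aemeasurable,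
    lintegral_bernoulliMeasure, lintegral_bernoulliMeasure]
  simp_rw [hexp, hA, h0]
  rw [lintegral_exp_neg_mul_expMeasure (by positivity)]
  simp only [lintegral_const, measure_univ, mul_one]
  have e : ENNReal.ofReal q + ENNReal.ofReal (1 - q) = 1 := by
    rw [← ENNReal.ofReal_add hq.1 (by linarith [hq.2])]; simp
  rw [e, mul_one, ← ENNReal.ofReal_mul hq.1,
    ← ENNReal.ofReal_add (mul_nonneg hq.1 (by positivity))
    (by linarith [hq.2]), ← ENNReal.ofReal_mul (by linarith [hp.2]),
    ← ENNReal.ofReal_add hp.1 (mul_nonneg (by linarith [hp.2])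
      (add_nonneg (mul_nonneg hq.1 (by positivity)) (by linarith [hq.2]))), ← ENNReal.ofReal_one,
    ← ENNReal.ofReal_sub _ (add_nonneg hp.1 (mul_nonneg (by linarith [hp.2])
      (add_nonneg (mul_nonneg hq.1 (by positivity)) (by linarith [hq.2]))))]
  congr 1
  rw [Real.rpow_neg (norm_nonneg _)]
  have h1 : 1 + s * (‖y‖ ^ α)⁻¹ ≠ 0 := by positivity
  have h2 : 1 + ‖y‖ ^ α / s ≠ 0 := by positivity
  field_simp
  ring

variable {Ω : Type*} [MeasurableSpace Ω] {P : Measure Ω} {lam : ℝ} {p q : unitInterval}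
  {X : ℕ → Ω → Plane} {file : ℕ → Ω → FilePortion} {t h : ℕ → Ω → ℝ}

namespace IsCachingNetwork

lemma measurable_mark (hnet : IsCachingNetwork P lam p q X file t h) (n : ℕ) :
    Measurable fun ω => ((file n ω, t n ω, h n ω) : Mark) :=
  (hnet.measurable_file n).prodMk ((hnet.measurable_t n).prodMk (hnet.measurable_h n))

lemma lintegral_mark (hnet : IsCachingNetwork P lam p q X file t h) (n : ℕ) {f : Mark → ℝ≥0∞}
    (hf : Measurable f) :
    ∫⁻ ω, f (file n ω, t n ω, h n ω) ∂P = ∫⁻ m, f m ∂(markLaw p q) :=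
  (hnet.mark_law n).lintegral_comp hf.aemeasurable

/-- Independence handles the finite partial products, and monotone convergence from above the
infimum. The functions may vary with `n`, since each device has its own frozen position. -/
lemma lintegral_infProd_mark [IsProbabilityMeasure P]
    (hnet : IsCachingNetwork P lam p q X file t h)
    {u : ℕ → Mark → ℝ≥0∞} (hu : ∀ n, Measurable (u n)) (hu1 : ∀ n m, u n m ≤ 1) :
    ∫⁻ ω, infProd (fun n => u n (file n ω, t n ω, h n ω)) ∂P =
      infProd fun n => ∫⁻ m, u n m ∂(markLaw p q) := by
  have hm : ∀ n, Measurable fun ω => u n (file n ω, t n ω, h n ω) :=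
    fun n => (hu n).comp (hnet.measurable_mark n)
  unfold infProd
  rw [MeasureTheory.lintegral_iInf (fun N => Finset.measurable_prod _ fun n _ => hm n)]
  · refine iInf_congr fun N => ?_
    have hi : iIndepFun (fun n ω => u n (file n ω, t n ω, h n ω)) P := hnet.mark_indep.comp u hu
    rw [lintegral_prod_of_iIndepFun _ hi fun n => (hm n).aemeasurable]
    exact Finset.prod_congr rfl fun n _ => hnet.lintegral_mark n (hu n)
  · exact fun a b hab ω => antitone_prod_range (fun n => hu1 n _) hab
  · simp

/-- Positions and marks can be integrated one after the other. -/
lemma lintegral_position_mark [IsProbabilityMeasure P]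
    (hnet : IsCachingNetwork P lam p q X file t h) {H : (ℕ → Plane) × (ℕ → Mark) → ℝ≥0∞}
    (hH : Measurable H) :
    ∫⁻ ω, H (fun n => X n ω, fun n => (file n ω, t n ω, h n ω)) ∂P =
      ∫⁻ ω, ∫⁻ ω', H (fun n => X n ω, fun n => (file n ω', t n ω', h n ω')) ∂P ∂P := by
  have hX : Measurable fun ω n => X n ω := measurable_pi_lambda _ hnet.ppp.measurable_point
  have hM : Measurable fun ω n => ((file n ω, t n ω, h n ω) : Mark) :=
    measurable_pi_lambda _ hnet.measurable_mark
  have := hnet.position_indep_mark.map_prod_eq_prod_map_map hX.aemeasurable hM.aemeasurable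
  calc _ = ∫⁻ z, H z ∂(P.map fun ω => (fun n => X n ω, fun n => (file n ω, t n ω, h n ω))) :=
        (lintegral_map hH (hX.prodMk hM)).symm
    _ = ∫⁻ x, ∫⁻ m, H (x, m) ∂(P.map fun ω n => (file n ω, t n ω, h n ω))
          ∂(P.map fun ω n => X n ω) := by
        have : IsProbabilityMeasure (P.map fun ω n => ((file n ω, t n ω, h n ω) : Mark)) :=
          Measure.isProbabilityMeasure_map hM.aemeasurable
        rw [‹P.map _ = _›, lintegral_prod _ hH.aemeasurable]
    _ = _ := by
        have : IsProbabilityMeasure (P.map fun ω n => ((file n ω, t n ω, h n ω) : Mark)) :=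
          Measure.isProbabilityMeasure_map hM.aemeasurable
        rw [lintegral_map hH.lintegral_prod_right' hX]
        refine lintegral_congr fun ω => ?_
        exact lintegral_map (hH.comp measurable_prodMk_left) hM

lemma lintegral_cutOff_weight (c : Plane) {s : ℝ} (α r : ℝ) (y : Plane) :
    ∫⁻ m, cutOff c (fun y => weight s α y m) r y ∂(markLaw p q) =
      cutOff c (meanWeight p q s α) r y := by
  unfold cutOff
  split_ifs <;> simp [meanWeight]

lemma measurable_cutOff_weight (c : Plane) (s α : ℝ) :
    Measurable fun z : ℝ × Plane × Mark => cutOff c (fun y => weight s α y z.2.2) z.1 z.2.1 := by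
  classical
  simp only [cutOff, Metric.mem_closedBall]
  exact Measurable.ite (measurableSet_le (measurable_snd.fst.dist measurable_const) measurable_fst)
    measurable_const ((measurable_weight s α).comp measurable_snd)

lemma measurable_cutOff_weight_right (c : Plane) (s α r : ℝ) (x : Plane) :
    Measurable fun m => cutOff c (fun y => weight s α y m) r x := by
  have hp : Measurable fun m : Mark => (r, x, m) := by fun_prop
  have h := (measurable_cutOff_weight c s α).comp hp
  simp only [Function.comp_def] at h
  exact h

lemma measurable_infProd_weight (c : Plane) (s α : ℝ) {ρ : (ℕ → Plane) × (ℕ → Mark) → ℝ}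
    (hρ : Measurable ρ) : Measurable fun z : (ℕ → Plane) × (ℕ → Mark) =>
      infProd fun n => cutOff c (fun y => weight s α y (z.2 n)) (ρ z) (z.1 n) := by
  have hp : ∀ n, Measurable fun z : (ℕ → Plane) × (ℕ → Mark) => (ρ z, z.1 n, z.2 n) := fun n =>
    hρ.prodMk (((measurable_pi_apply n).comp measurable_fst).prodMk
      ((measurable_pi_apply n).comp measurable_snd))
  have hm := fun n => (measurable_cutOff_weight c s α).comp (hp n)
  exact measurable_infProd hm

/-- The mean over positions and marks of the product of the factors outside a fixed disc. -/
lemma lintegral_infProd_weight [IsProbabilityMeasure P]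
    (hnet : IsCachingNetwork P lam p q X file t h) (c : Plane) {s : ℝ} (hs : 0 ≤ s) (α r : ℝ) :
    ∫⁻ ω, infProd (fun n =>
        cutOff c (fun y => weight s α y (file n ω, t n ω, h n ω)) r (X n ω)) ∂P =
      outerMean P X c (meanWeight p q s α) r := by
  have hH : Measurable fun z : (ℕ → Plane) × (ℕ → Mark) =>
      infProd fun n => cutOff c (fun y => weight s α y (z.2 n)) r (z.1 n) :=
    measurable_infProd_weight c s α measurable_const
  have hsplit := hnet.lintegral_position_mark hH
  simp only at hsplit
  rw [hsplit]
  refine lintegral_congr fun ω => ?_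
  have hu : ∀ n, Measurable fun m => cutOff c (fun y => weight s α y m) r (X n ω) := fun n =>
    measurable_cutOff_weight_right c s α r (X n ω)
  have := hnet.lintegral_infProd_mark (u := fun n m => cutOff c (fun y => weight s α y m) r (X n ω))
    hu (fun n m => cutOff_weight_le_one hs α c m r (X n ω))
  simp only [lintegral_cutOff_weight] at this
  exact this

end IsCachingNetwork

/-- The event that a closest device caches file B. -/
def closestB (c : Plane) : Set ((ℕ → Plane) × (ℕ → Mark)) :=
  {z | ∃ n, dist c (z.1 n) ≤ minDist c z.1 ∧ (z.2 n).1 = FilePortion.B}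

lemma measurableSet_closestB (c : Plane) : MeasurableSet (closestB c) := by
  have : closestB c = ⋃ n, {z | dist c (z.1 n) ≤ minDist c z.1} ∩
      {z | (z.2 n).1 = FilePortion.B} := by
    ext z; simp [closestB]
  rw [this]
  refine MeasurableSet.iUnion fun n => MeasurableSet.inter ?_ ?_
  · exact measurableSet_le (by fun_prop) ((measurable_minDist c).comp measurable_fst)
  · exact (by fun_prop : Measurable fun z : (ℕ → Plane) × (ℕ → Mark) => (z.2 n).1)
      (measurableSet_singleton FilePortion.B)

namespace IsCachingNetwork

lemma markLaw_B (p q : unitInterval) :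
    ∫⁻ m, ({m : Mark | m.1 = FilePortion.B}).indicator 1 m ∂(markLaw p q) =
      ENNReal.ofReal (1 - p) := by
  have hm : MeasurableSet {m : Mark | m.1 = FilePortion.B} :=
    measurable_fst (measurableSet_singleton FilePortion.B)
  rw [markLaw, lintegral_prod _ (measurable_one.indicator hm).aemeasurable,
    lintegral_bernoulliMeasure]
  simp [indicator]

/-- On the event that the closest device caches B, the marks of the other devices are averaged
as before. -/
lemma setLIntegral_closestB [IsProbabilityMeasure P]
    (hnet : IsCachingNetwork P lam p q X file t h) (hlam : 0 < lam) (c : Plane) {s : ℝ}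
    (hs : 0 ≤ s) (α : ℝ) {ψ : ℝ → ℝ≥0∞} (hψ : Measurable ψ) :
    ∫⁻ ω in {ω | (fun n => X n ω, fun n => (file n ω, t n ω, h n ω)) ∈ closestB c},
        ψ (minDist c fun n => X n ω) * infProd (fun n =>
          cutOff c (fun y => weight s α y (file n ω, t n ω, h n ω))
            (minDist c fun n => X n ω) (X n ω)) ∂P =
      ENNReal.ofReal (1 - p) * ∫⁻ ω, ψ (minDist c fun n => X n ω) * infProd (fun n =>
          cutOff c (meanWeight p q s α) (minDist c fun n => X n ω) (X n ω)) ∂P := by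
  have hX : Measurable fun ω n => X n ω := measurable_pi_lambda _ hnet.ppp.measurable_point
  have hM : Measurable fun ω n => ((file n ω, t n ω, h n ω) : Mark) :=
    measurable_pi_lambda _ hnet.measurable_mark
  let G : (ℕ → Plane) × (ℕ → Mark) → ℝ≥0∞ := fun z =>
    infProd fun n => cutOff c (fun y => weight s α y (z.2 n)) (minDist c z.1) (z.1 n)
  have hG : Measurable G := measurable_infProd_weight c s α ((measurable_minDist c).comp measurable_fst)
  have hind : Measurable ((closestB c).indicator (1 : (ℕ → Plane) × (ℕ → Mark) → ℝ≥0∞)) :=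
    measurable_one.indicator (measurableSet_closestB c)
  let H : (ℕ → Plane) × (ℕ → Mark) → ℝ≥0∞ := fun z =>
    ψ (minDist c z.1) * ((closestB c).indicator 1 z * G z)
  have hH : Measurable H :=
    (hψ.comp ((measurable_minDist c).comp measurable_fst)).mul (hind.mul hG)
  have hS : MeasurableSet {ω | ((fun n => X n ω, fun n => (file n ω, t n ω, h n ω)) :
      (ℕ → Plane) × (ℕ → Mark)) ∈ closestB c} := (hX.prodMk hM) (measurableSet_closestB c)
  have hψ' : Measurable fun ω => ψ (minDist c fun n => X n ω) :=
    hψ.comp (hnet.ppp.measurable_minDist c)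
  have hR : Measurable fun ω => ψ (minDist c fun n => X n ω) * infProd (fun n =>
      cutOff c (meanWeight p q s α) (minDist c fun n => X n ω) (X n ω)) :=
    hψ'.mul (hnet.ppp.measurable_infProd_cutOff c (measurable_meanWeight p q s α)
      (hnet.ppp.measurable_minDist c))
  rw [← lintegral_indicator hS, ← lintegral_const_mul _ hR]
  refine Eq.trans (lintegral_congr fun ω => ?_) ((hnet.lintegral_position_mark hH).trans ?_)
  · simp only [H, G, indicator, mem_ofPred_eq]
    split_ifs <;> simp
  refine lintegral_congr_ae ?_
  filter_upwards [hnet.ppp.ae_locally_finite c, hnet.ppp.ae_dist_injective hlam c]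
    with ω hfin hinj
  -- With the positions frozen, the index of the closest device is a constant `n₀`, and injectivity
  -- of the distances makes it the only candidate in `closestB`.
  obtain ⟨n₀, hn₀⟩ := exists_dist_eq_minDist hfin
  set r := minDist c fun n => X n ω with hr
  have hclosest : ∀ m : ℕ → Mark,
      ((fun n => X n ω, m) ∈ closestB c ↔ (m n₀).1 = FilePortion.B) := by
    intro m
    constructor
    · rintro ⟨n, hn, hB⟩
      have h1 : dist c (X n ω) = dist c (X n₀ ω) :=
        le_antisymm (hn.trans hn₀.ge) (hn₀.le.trans (le_minDist_iff.1 le_rfl n))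
      rwa [← hinj h1]
    · intro hB
      exact ⟨n₀, hn₀.le, hB⟩
  -- The exclusion disc is closed, so the closest device lies in it and its factor is `1`. The slot
  -- `n₀` is thus free to carry the indicator that its file is B.
  have hcut : ∀ g : Plane → ℝ≥0∞, cutOff c g r (X n₀ ω) = 1 := fun g => by
    rw [cutOff, if_pos]
    rw [Metric.mem_closedBall, dist_comm]
    exact hn₀.le
  let u : ℕ → Mark → ℝ≥0∞ := fun n m =>
    if n = n₀ then ({m : Mark | m.1 = FilePortion.B}).indicator 1 m
    else cutOff c (fun y => weight s α y m) r (X n ω)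
  have hBm : MeasurableSet {m : Mark | m.1 = FilePortion.B} :=
    measurable_fst (measurableSet_singleton FilePortion.B)
  have hu : ∀ n, Measurable (u n) := fun n => by
    by_cases hn : n = n₀
    · simp only [u, hn, if_true]
      exact measurable_one.indicator hBm
    · simp only [u, hn, if_false]
      exact measurable_cutOff_weight_right c s α r (X n ω)
  have hu1 : ∀ n m, u n m ≤ 1 := fun n m => by
    simp only [u]
    split_ifs
    · exact indicator_le_self' (by simp) m
    · exact cutOff_weight_le_one hs α c m r (X n ω)
  have hsplit : ∀ m : ℕ → Mark, (closestB c).indicator 1 (fun n => X n ω, m) *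
      G (fun n => X n ω, m) = infProd fun n => u n (m n) := by
    intro m
    have h1 : (closestB c).indicator (1 : (ℕ → Plane) × (ℕ → Mark) → ℝ≥0∞) (fun n => X n ω, m) =
        ({m : Mark | m.1 = FilePortion.B}).indicator 1 (m n₀) := by
      by_cases hB : (m n₀).1 = FilePortion.B
      · rw [indicator_of_mem ((hclosest m).2 hB), indicator_of_mem (by exact hB)]
        rfl
      · rw [indicator_of_notMem (mt (hclosest m).1 hB), indicator_of_notMem (by exact hB)]
    have h2 : ({m : Mark | m.1 = FilePortion.B}).indicator (1 : Mark → ℝ≥0∞) (m n₀) ≤ 1 :=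
      indicator_le_self' (by simp) _
    rw [h1, ← infProd_single n₀ h2, ← infProd_mul (fun n => by split_ifs <;> simp [h2])
      (fun n => cutOff_weight_le_one hs α c (m n) r (X n ω))]
    congr 1
    funext n
    by_cases hn : n = n₀
    · subst hn
      simp only [u, if_true]
      rw [hcut, mul_one]
    · simp only [u, hn, if_false, one_mul]
  have hmean : ∀ n, ∫⁻ m, u n m ∂(markLaw p q) = (if n = n₀ then ENNReal.ofReal (1 - p) else 1) *
      cutOff c (meanWeight p q s α) r (X n ω) := fun n => by
    by_cases hn : n = n₀
    · subst hn
      simp only [u, if_true]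
      rw [hcut, mul_one, markLaw_B]
    · simp only [u, hn, if_false, one_mul]
      exact lintegral_cutOff_weight c α r _
  have hp1 : ENNReal.ofReal (1 - (p : ℝ)) ≤ 1 := by
    rw [ENNReal.ofReal_le_one]; linarith [p.2.1]
  calc ∫⁻ ω', H (fun n => X n ω, fun n => (file n ω', t n ω', h n ω')) ∂P
      = ∫⁻ ω', ψ r * infProd (fun n => u n (file n ω', t n ω', h n ω')) ∂P :=
        lintegral_congr fun ω' => by
          simp only [H]
          rw [hsplit]
    _ = ψ r * (ENNReal.ofReal (1 - p) * infProd fun n =>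
          cutOff c (meanWeight p q s α) r (X n ω)) := by
        have hm : Measurable fun ω' => infProd fun n => u n (file n ω', t n ω', h n ω') :=
          measurable_infProd (a := fun n ω' => u n (file n ω', t n ω', h n ω')) fun n =>
            (hu n).comp (hnet.measurable_mark n)
        rw [lintegral_const_mul _ hm, hnet.lintegral_infProd_mark hu hu1]
        simp_rw [hmean]
        rw [infProd_mul (fun n => by split_ifs <;> simp [hp1])
          (fun n => cutOff_le_one (fun y => meanWeight_le_one p q hs α y) _ _),
          infProd_single n₀ hp1]
    _ = _ := by ring

end IsCachingNetwork
end D2DCaching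

/-! ### The area integral outside the disc in polar coordinates. -/

namespace D2DCaching

lemma mem_closedBall_location1 {v r₁ : ℝ} (hr₁ : 0 < r₁) (x : Plane) :
    x ∈ Metric.closedBall (location1 v) r₁ ↔ (x 0 + v) ^ 2 + x 1 ^ 2 ≤ r₁ ^ 2 := by
  rw [Metric.mem_closedBall, EuclideanSpace.dist_eq, Fin.sum_univ_two, Real.sqrt_le_left hr₁.le]
  simp [location1, Real.dist_eq, sq_abs]

lemma lintegral_plane_polar {F : ℝ × ℝ → ℝ≥0∞} (hF : Measurable F) :
    ∫⁻ x : Plane, F (x 0, x 1) = ∫⁻ r in Ioi (0 : ℝ), ∫⁻ θ in Ioo (-Real.pi) Real.pi,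
      ENNReal.ofReal r * F (r * Real.cos θ, r * Real.sin θ) := by
  have h1 : ∫⁻ x : Plane, F (x 0, x 1) = ∫⁻ z : ℝ × ℝ, F z :=
    ((volume_preserving_finTwoArrow ℝ).comp
      (PiLp.volume_preserving_ofLp (Fin 2))).lintegral_comp hF
  have hm : Measurable fun z : ℝ × ℝ =>
      ENNReal.ofReal z.1 * F (z.1 * Real.cos z.2, z.1 * Real.sin z.2) := by fun_prop
  rw [h1, ← lintegral_comp_polarCoord_symm, polarCoord_target, Measure.volume_eq_prod,
    ← Measure.prod_restrict, ← lintegral_prod _ hm.aemeasurable]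
  rfl

/-- `Real.arccos` is constant beyond `-1` and beyond `1`, which is exactly what makes the
equivalence hold for every real `d`. -/
lemma neg_lt_cos_iff {d θ : ℝ} (hθ : θ ∈ Ioo (-Real.pi) Real.pi) :
    d < Real.cos θ ↔ |θ| < Real.arccos d := by
  have habs : |θ| < Real.pi := abs_lt.2 hθ
  rcases lt_or_ge d (-1) with h | h
  · rw [Real.arccos_of_le_neg_one h.le]
    exact iff_of_true (h.trans_le (Real.neg_one_le_cos θ)) habs
  rcases le_or_gt 1 d with h' | h'
  · rw [Real.arccos_of_one_le h']
    exact iff_of_false (not_lt.2 ((Real.cos_le_one θ).trans h')) (not_lt.2 (abs_nonneg _))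
  · rw [← Real.strictAntiOn_arccos.lt_iff_gt ⟨Real.neg_one_le_cos θ, Real.cos_le_one θ⟩ ⟨h, h'.le⟩,
      ← Real.cos_abs, Real.arccos_cos (abs_nonneg _) habs.le]

/-- Half the angular measure of the part of the circle of radius `r` around location 2 that lies in
the disc of radius `r₁` around location 1. -/
noncomputable def arc (v r₁ r : ℝ) : ℝ :=
  if v = 0 then if r ≤ r₁ then Real.pi else 0 else angle v r r₁

lemma measurable_angle (v r₁ : ℝ) : Measurable fun r => angle v r r₁ := by
  unfold angle
  exact Real.continuous_arccos.measurable.comp (by fun_prop)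

lemma measurable_arc (v r₁ : ℝ) : Measurable (arc v r₁) := by
  unfold arc
  by_cases hv : v = 0
  · simp only [hv, if_true]
    exact Measurable.ite measurableSet_Iic measurable_const measurable_const
  · simp only [hv, if_false]
    exact measurable_angle v r₁

lemma arc_nonneg (v r₁ r : ℝ) : 0 ≤ arc v r₁ r := by
  unfold arc
  split_ifs
  exacts [Real.pi_pos.le, le_rfl, Real.arccos_nonneg _]

lemma arc_le_pi (v r₁ r : ℝ) : arc v r₁ r ≤ Real.pi := by
  unfold arc
  split_ifs
  exacts [le_rfl, Real.pi_pos.le, Real.arccos_le_pi _]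

/-- By the law of cosines the squared distance from location 1 is `r ^ 2 + v ^ 2 + 2 * r * v * cos
θ`. It exceeds `r₁ ^ 2` exactly when `|θ|` is below the arccosine of minus the quotient in `angle`,
and that arccosine is `π - angle v r r₁`. -/
lemma volume_arc {v r₁ r : ℝ} (hv : 0 ≤ v) (hr₁ : 0 < r₁) (hr : 0 < r) :
    volume ({θ | ¬ (r * Real.cos θ + v) ^ 2 + (r * Real.sin θ) ^ 2 ≤ r₁ ^ 2} ∩
      Ioo (-Real.pi) Real.pi) = ENNReal.ofReal (2 * (Real.pi - arc v r₁ r)) := by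
  have hsq : ∀ θ, (r * Real.cos θ + v) ^ 2 + (r * Real.sin θ) ^ 2 =
      r ^ 2 + v ^ 2 + 2 * r * v * Real.cos θ := fun θ => by
    linear_combination r ^ 2 * Real.sin_sq_add_cos_sq θ
  simp only [hsq, not_le]
  -- For `v = 0` the quotient in `angle` is a division by zero and carries no information; circle
  -- and disc are then concentric.
  rcases hv.eq_or_lt with rfl | hv
  · by_cases h : r ≤ r₁
    · have : ¬ r₁ ^ 2 < r ^ 2 := not_lt.2 (by gcongr)
      simp [arc, h, this]
    · have : r₁ ^ 2 < r ^ 2 := by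
        have := not_le.1 h
        gcongr
      simp only [arc, h, if_true, if_false]
      have hset : {θ : ℝ | r₁ ^ 2 < r ^ 2 + 0 ^ 2 + 2 * r * 0 * Real.cos θ} = univ :=
        eq_univ_of_forall fun θ => by simpa using this
      rw [hset, univ_inter, Real.volume_Ioo]
      congr 1
      ring
  · have hset : {θ | r₁ ^ 2 < r ^ 2 + v ^ 2 + 2 * r * v * Real.cos θ} ∩ Ioo (-Real.pi) Real.pi =
        Ioo (-(Real.pi - angle v r r₁)) (Real.pi - angle v r r₁) := by
      have hlt : ∀ θ, r₁ ^ 2 < r ^ 2 + v ^ 2 + 2 * r * v * Real.cos θ ↔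
          -((r ^ 2 + v ^ 2 - r₁ ^ 2) / (2 * r * v)) < Real.cos θ := fun θ => by
        rw [← sub_pos, ← sub_pos (b := -_), ← mul_pos_iff_of_pos_left (b := _ - -_)
          (show 0 < 2 * r * v by positivity)]
        have : 2 * r * v * (Real.cos θ - -((r ^ 2 + v ^ 2 - r₁ ^ 2) / (2 * r * v))) =
          r ^ 2 + v ^ 2 + 2 * r * v * Real.cos θ - r₁ ^ 2 := by
          field_simp
          ring
        rw [this]
      ext θ
      have hle : Real.pi - angle v r r₁ ≤ Real.pi := by
        have := Real.arccos_nonneg ((r ^ 2 + v ^ 2 - r₁ ^ 2) / (2 * r * v))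
        rw [angle]; linarith
      rw [mem_inter_iff, mem_ofPred_eq, hlt, mem_Ioo (a := -(_ - _)), ← abs_lt]
      constructor
      · rintro ⟨h1, h2⟩
        rwa [neg_lt_cos_iff h2, Real.arccos_neg] at h1
      · intro h
        have h2 : θ ∈ Ioo (-Real.pi) Real.pi := abs_lt.1 (h.trans_le hle)
        exact ⟨by rwa [neg_lt_cos_iff h2, Real.arccos_neg], h2⟩
    rw [hset, Real.volume_Ioo, arc, if_neg hv.ne']
    congr 1
    ring

open Classical in
lemma lintegral_outside_disc {v r₁ : ℝ} (hv : 0 ≤ v) (hr₁ : 0 < r₁) {φ : ℝ → ℝ}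
    (hφ : Measurable φ) (hφ0 : ∀ r, 0 < r → 0 ≤ φ r) :
    ∫⁻ x : Plane, (if x ∈ Metric.closedBall (location1 v) r₁ then 0 else
        ENNReal.ofReal (φ ‖x‖)) =
      ∫⁻ r in Ioi (0 : ℝ), ENNReal.ofReal (2 * ((Real.pi - arc v r₁ r) * (r * φ r))) := by
  let F : ℝ × ℝ → ℝ≥0∞ := fun z => if (z.1 + v) ^ 2 + z.2 ^ 2 ≤ r₁ ^ 2 then 0 else
    ENNReal.ofReal (φ (√(z.1 ^ 2 + z.2 ^ 2)))
  have hF : Measurable F := Measurable.ite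
    (measurableSet_le (f := fun z : ℝ × ℝ => (z.1 + v) ^ 2 + z.2 ^ 2) (by fun_prop)
      measurable_const) measurable_const (by fun_prop)
  have h1 : ∀ x : Plane, (if x ∈ Metric.closedBall (location1 v) r₁ then 0 else
      ENNReal.ofReal (φ ‖x‖)) = F (x 0, x 1) := fun x => by
    simp only [mem_closedBall_location1 hr₁, F]
    rw [EuclideanSpace.norm_eq, Fin.sum_univ_two]
    simp only [Real.norm_eq_abs, sq_abs]
  simp_rw [h1]
  rw [lintegral_plane_polar hF]
  refine setLIntegral_congr_fun measurableSet_Ioi fun r (hr : 0 < r) => ?_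
  have hS : MeasurableSet {θ | ¬ (r * Real.cos θ + v) ^ 2 + (r * Real.sin θ) ^ 2 ≤ r₁ ^ 2} :=
    (measurableSet_le (f := fun θ => (r * Real.cos θ + v) ^ 2 + (r * Real.sin θ) ^ 2)
      (by fun_prop) measurable_const).compl
  have h2 : ∀ θ, ENNReal.ofReal r * F (r * Real.cos θ, r * Real.sin θ) =
      {θ | ¬ (r * Real.cos θ + v) ^ 2 + (r * Real.sin θ) ^ 2 ≤ r₁ ^ 2}.indicator
        (fun _ => ENNReal.ofReal (r * φ r)) θ := fun θ => by
    have h3 : √((r * Real.cos θ) ^ 2 + (r * Real.sin θ) ^ 2) = r := by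
      rw [show (r * Real.cos θ) ^ 2 + (r * Real.sin θ) ^ 2 = r ^ 2 by
        linear_combination r ^ 2 * Real.sin_sq_add_cos_sq θ, Real.sqrt_sq hr.le]
    simp only [F, h3, indicator, mem_ofPred_eq]
    by_cases h : (r * Real.cos θ + v) ^ 2 + (r * Real.sin θ) ^ 2 ≤ r₁ ^ 2
    · simp [h]
    · simp [h, ENNReal.ofReal_mul hr.le]
  simp_rw [h2]
  rw [lintegral_indicator_const hS, Measure.restrict_apply hS, volume_arc hv hr₁ hr,
    ← ENNReal.ofReal_mul (mul_nonneg hr.le (hφ0 r hr))]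
  congr 1
  ring

/-- Such a circle lies wholly inside the disc: its farthest point from location 1 is at distance `r
+ v ≤ r₁`. -/
lemma arc_of_le {v r₁ r : ℝ} (hv : 0 ≤ v) (hr : 0 < r) (h : r ≤ max 0 (r₁ - v)) :
    arc v r₁ r = Real.pi := by
  have h' : r ≤ r₁ - v := (le_max_iff.1 h).resolve_left (not_le.2 hr)
  rcases hv.eq_or_lt with rfl | hv
  · simp only [arc, if_true]
    rw [if_pos (by linarith)]
  · rw [arc, if_neg hv.ne', angle, Real.arccos_of_le_neg_one]
    rw [div_le_iff₀ (by positivity)]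
    nlinarith

/-- The distance from location 1 to the circle is `|r - v|`, and the two hypotheses on `r` force it
to be at least `r₁`, so at most a tangency remains. -/
lemma arc_eq_zero {v r₁ r : ℝ} (hv : 0 ≤ v) (hr₁ : 0 < r₁) (h : max 0 (r₁ - v) < r)
    (h' : r ∉ Ioc |v - r₁| (v + r₁)) : arc v r₁ r = 0 := by
  obtain ⟨hr, hr'⟩ := max_lt_iff.1 h
  rcases hv.eq_or_lt with rfl | hv
  · simp only [arc, if_true]
    rw [if_neg (by linarith)]
  · rw [arc, if_neg hv.ne', angle, Real.arccos_of_one_le]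
    rw [le_div_iff₀ (by positivity)]
    have hsq : r₁ ^ 2 ≤ (r - v) ^ 2 := by
      rw [mem_Ioc, not_and_or, not_lt, not_le] at h'
      rcases h' with h' | h'
      · rcases le_abs.1 h' with h'' | h''
        · nlinarith
        · linarith
      · nlinarith
    nlinarith

/-- Bounded by `1` up to `r = 1` and by `s * r ^ (1 - α)` beyond, which is integrable since `α > 2`.
-/
lemma integrableOn_radial {s α : ℝ} (hs : 0 < s) (hα : 2 < α) :
    IntegrableOn (fun r : ℝ => r * (1 / (1 + r ^ α / s))) (Ioi 0) := by
  have hm : Measurable fun r : ℝ => r * (1 / (1 + r ^ α / s)) := by fun_prop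
  rw [← Ioc_union_Ioi_eq_Ioi (zero_le_one' ℝ), integrableOn_union]
  constructor
  · refine Integrable.mono' (g := fun _ => (1 : ℝ)) (integrableOn_const (by simp)) hm.aestronglyMeasurable
      (ae_restrict_of_forall_mem measurableSet_Ioc fun r hr => ?_)
    have hp : 0 < r ^ α := Real.rpow_pos_of_pos hr.1 _
    have h1 : 1 / (1 + r ^ α / s) ≤ 1 := by
      rw [div_le_one (by positivity)]
      have : 0 < r ^ α / s := by positivity
      linarith
    have h0 : 0 ≤ 1 / (1 + r ^ α / s) := by positivity
    rw [Real.norm_eq_abs, abs_of_nonneg (mul_nonneg hr.1.le h0)]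
    exact mul_le_one₀ hr.2 h0 h1
  · refine Integrable.mono' ((integrableOn_Ioi_rpow_of_lt (a := 1 - α) (by linarith) one_pos).const_mul s)
      hm.aestronglyMeasurable (ae_restrict_of_forall_mem measurableSet_Ioi fun r (hr : 1 < r) => ?_)
    have hr0 : 0 < r := one_pos.trans hr
    have hp : 0 < r ^ α := Real.rpow_pos_of_pos hr0 _
    rw [Real.norm_eq_abs, abs_of_nonneg (by positivity), Real.rpow_sub hr0, Real.rpow_one]
    rw [mul_one_div, mul_div_assoc', div_le_div_iff₀ (by positivity) hp]
    have : s * r * (1 + r ^ α / s) = s * r + r * r ^ α := by field_simp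
    rw [this]
    have : 0 < s * r := by positivity
    linarith

/-- The integrand `π - arc` vanishes up to `max 0 (r₁ - v)`. Beyond that point `arc` lives on the
interval of the second integral, where it is `angle`. -/
lemma integral_arc {v r₁ s α : ℝ} (hv : 0 ≤ v) (hr₁ : 0 < r₁) (hs : 0 < s) (hα : 2 < α) :
    IntegrableOn (fun r : ℝ => Real.pi * r / (1 + r ^ α / s)) (Ioi (max 0 (r₁ - v))) ∧
    IntervalIntegrable (fun r : ℝ => angle v r r₁ * r / (1 + r ^ α / s)) volume
      |v - r₁| (v + r₁) ∧
    IntegrableOn (fun r : ℝ => (Real.pi - arc v r₁ r) * (r * (1 / (1 + r ^ α / s)))) (Ioi 0) ∧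
    ∫ r in Ioi (0 : ℝ), (Real.pi - arc v r₁ r) * (r * (1 / (1 + r ^ α / s))) =
      (∫ r in Ioi (max 0 (r₁ - v)), Real.pi * r / (1 + r ^ α / s)) -
      ∫ r in |v - r₁|..(v + r₁), angle v r r₁ * r / (1 + r ^ α / s) := by
  set ψ : ℝ → ℝ := fun r => r * (1 / (1 + r ^ α / s)) with hψ
  have hint : IntegrableOn ψ (Ioi 0) := integrableOn_radial hs hα
  have hpi : ∀ r : ℝ, Real.pi * r / (1 + r ^ α / s) = Real.pi * ψ r := fun r => by
    simp only [hψ]; ring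
  have hang : ∀ r : ℝ, angle v r r₁ * r / (1 + r ^ α / s) = angle v r r₁ * ψ r := fun r => by
    simp only [hψ]; ring
  have hbdd : ∀ f : ℝ → ℝ, Measurable f → (∀ r, |f r| ≤ Real.pi) →
      IntegrableOn (fun r => f r * ψ r) (Ioi 0) := fun f hf hb =>
    Integrable.bdd_mul hint hf.aestronglyMeasurable (ae_of_all _ hb)
  have hπ := hbdd (fun _ => Real.pi) measurable_const fun _ => (abs_of_pos Real.pi_pos).le
  have hA := hbdd (fun r => angle v r r₁) (measurable_angle v r₁) fun r => by
    rw [angle, abs_of_nonneg (Real.arccos_nonneg _)]; exact Real.arccos_le_pi _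
  have harc := hbdd (arc v r₁) (measurable_arc v r₁) fun r => by
    rw [abs_of_nonneg (arc_nonneg _ _ _)]; exact arc_le_pi _ _ _
  have hz : Ioi (max 0 (r₁ - v)) ⊆ Ioi 0 := Ioi_subset_Ioi (le_max_left _ _)
  have hle : |v - r₁| ≤ v + r₁ := abs_le.2 ⟨by linarith, by linarith⟩
  have hIoc : Ioc |v - r₁| (v + r₁) ⊆ Ioi (max 0 (r₁ - v)) := fun r hr =>
    mem_Ioi.2 (max_lt ((abs_nonneg _).trans_lt hr.1)
      (lt_of_le_of_lt (by rw [← neg_sub]; exact neg_le_abs _) hr.1))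
  have hdiff := hbdd (fun r => Real.pi - arc v r₁ r) (measurable_const.sub (measurable_arc v r₁))
    fun r => by
      rw [abs_of_nonneg (sub_nonneg.2 (arc_le_pi _ _ _))]
      linarith [arc_nonneg v r₁ r]
  simp_rw [hpi, hang]
  refine ⟨hπ.mono_set hz, ?_, hdiff, ?_⟩
  · rw [intervalIntegrable_iff_integrableOn_Ioc_of_le hle]
    exact hA.mono_set (hIoc.trans hz)
  · have hcut : ∫ r in Ioi (0 : ℝ), (Real.pi - arc v r₁ r) * ψ r =
        ∫ r in Ioi (max 0 (r₁ - v)), (Real.pi * ψ r - arc v r₁ r * ψ r) := by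
      simp_rw [← sub_mul]
      exact setIntegral_eq_of_subset_of_forall_sdiff_eq_zero measurableSet_Ioi hz fun r hr => by
        rw [arc_of_le hv hr.1 (not_lt.1 hr.2), sub_self, zero_mul]
    have hcut' : ∫ r in Ioi (max 0 (r₁ - v)), arc v r₁ r * ψ r =
        ∫ r in Ioc |v - r₁| (v + r₁), arc v r₁ r * ψ r :=
      setIntegral_eq_of_subset_of_forall_sdiff_eq_zero measurableSet_Ioi hIoc fun r hr => by
        rw [arc_eq_zero hv hr₁ hr.1 hr.2, zero_mul]
    rw [hcut, integral_sub (hπ.mono_set hz) (harc.mono_set hz), intervalIntegral.integral_of_le hle,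
      hcut']
    congr 1
    refine setIntegral_congr_fun measurableSet_Ioc fun r hr => ?_
    -- For `v = 0` both endpoints equal `r₁` and the interval is empty, so the value of `angle`
    -- there is irrelevant.
    have h0 : v ≠ 0 := by
      rintro rfl
      have h1 := hr.1
      rw [zero_sub, abs_neg, abs_of_pos hr₁] at h1
      linarith [hr.2]
    simp only [arc, h0, if_false]

end D2DCaching

/-! ### Finiteness of the interference and the value of the exponent. -/

namespace D2DCaching

/-- Comparison with a function known to be integrable on the plane; the constant comes from `(1 +
‖y‖) / 2 ≤ ‖y‖`. -/
lemma rpow_neg_norm_le {α : ℝ} (hα : 0 < α) {y : Plane} (hy : 1 ≤ ‖y‖) :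
    ‖y‖ ^ (-α) ≤ 2 ^ α * (1 + ‖y‖) ^ (-α) := by
  have h : (1 + ‖y‖) / 2 ≤ ‖y‖ := by linarith
  have h2 := Real.rpow_le_rpow_of_nonpos (by positivity) h (neg_nonpos.2 hα.le)
  rw [Real.div_rpow (by positivity) (by norm_num), Real.rpow_neg (by norm_num : (0 : ℝ) ≤ 2),
    div_inv_eq_mul] at h2
  linarith

lemma lintegral_one_add_norm_ne_top {α : ℝ} (hα : 2 < α) (C : ℝ) :
    ∫⁻ y : Plane, ENNReal.ofReal (C * (1 + ‖y‖) ^ (-α)) ≠ ⊤ :=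
  ((integrable_one_add_norm (by simpa using hα)).const_mul C).lintegral_lt_top.ne

open Classical in
/-- The path gain outside the unit disc. -/
noncomputable def farGain (α : ℝ) (y : Plane) : ℝ := if 1 ≤ ‖y‖ then ‖y‖ ^ (-α) else 0

lemma measurable_farGain (α : ℝ) : Measurable (farGain α) := by
  classical
  exact Measurable.ite (measurableSet_le measurable_const measurable_norm) (by fun_prop)
    measurable_const

lemma farGain_nonneg (α : ℝ) (y : Plane) : 0 ≤ farGain α y := by
  unfold farGain; split_ifs <;> positivity

lemma lintegral_farGain_ne_top {α : ℝ} (hα : 2 < α) :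
    ∫⁻ y, ENNReal.ofReal (farGain α y) ≠ ⊤ := by
  refine ne_top_of_le_ne_top (lintegral_one_add_norm_ne_top hα (2 ^ α))
    (lintegral_mono fun y => ENNReal.ofReal_le_ofReal ?_)
  unfold farGain
  split_ifs with h
  · exact rpow_neg_norm_le (by linarith) h
  · positivity

/-- The integrand is at most `1` on the unit disc and at most `s * ‖y‖ ^ (-α)` outside. -/
lemma lintegral_one_sub_meanWeight_ne_top (p q : unitInterval) {s α : ℝ} (hs : 0 < s)
    (hα : 2 < α) : ∫⁻ y, (1 - meanWeight p q s α y) ≠ ⊤ := by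
  refine ne_top_of_le_ne_top (b := ∫⁻ y, ((Metric.closedBall (0 : Plane) 1).indicator 1 y +
    ENNReal.ofReal s * ENNReal.ofReal (farGain α y))) ?_ (lintegral_mono fun y => ?_)
  · rw [lintegral_add_left (measurable_one.indicator measurableSet_closedBall),
      lintegral_indicator_one measurableSet_closedBall,
      lintegral_const_mul _ (measurable_farGain α).ennreal_ofReal]
    exact ENNReal.add_ne_top.2 ⟨measure_closedBall_lt_top.ne,
      ENNReal.mul_ne_top ENNReal.ofReal_ne_top (lintegral_farGain_ne_top hα)⟩
  · by_cases h : y ∈ Metric.closedBall (0 : Plane) 1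
    · rw [indicator_of_mem h]
      exact tsub_le_self.trans le_self_add
    · have hy : 1 < ‖y‖ := by simpa using h
      have hpos : 0 < ‖y‖ ^ α := Real.rpow_pos_of_pos (by linarith) _
      rw [one_sub_meanWeight p q hs (norm_pos_iff.1 (by linarith)),
        indicator_of_notMem h, zero_add, ← ENNReal.ofReal_mul hs.le]
      refine ENNReal.ofReal_le_ofReal ?_
      have h1 : (1 - (p : ℝ)) * q ≤ 1 :=
        mul_le_one₀ (by linarith [p.2.1]) q.2.1 q.2.2
      have h2 : 1 / (1 + ‖y‖ ^ α / s) ≤ s * farGain α y := by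
        rw [farGain, if_pos hy.le, Real.rpow_neg (norm_nonneg _), ← div_eq_mul_inv,
          div_le_div_iff₀ (by positivity) hpos]
        have : s * (1 + ‖y‖ ^ α / s) = s + ‖y‖ ^ α := by field_simp
        linarith
      have h3 : 0 ≤ 1 / (1 + ‖y‖ ^ α / s) := by positivity
      calc (1 - (p : ℝ)) * q * (1 / (1 + ‖y‖ ^ α / s)) ≤ 1 * (1 / (1 + ‖y‖ ^ α / s)) :=
            mul_le_mul_of_nonneg_right h1 h3
        _ ≤ _ := by rwa [one_mul]

lemma lintegral_abs_mark_ne_top (p q : unitInterval) :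
    ∫⁻ m : Mark, ENNReal.ofReal |m.2.1 * m.2.2| ∂(markLaw p q) ≠ ⊤ := by
  have hm : Measurable fun m : Mark => ENNReal.ofReal |m.2.1 * m.2.2| := by fun_prop
  have hm2 : ∀ f : FilePortion, Measurable fun z : ℝ × ℝ => ENNReal.ofReal |z.1 * z.2| :=
    fun _ => by fun_prop
  have hfin := lintegral_abs_expMeasure_ne_top
  rw [markLaw, lintegral_prod _ hm.aemeasurable, lintegral_bernoulliMeasure,
    lintegral_prod _ (hm2 FilePortion.A).aemeasurable, lintegral_bernoulliMeasure]
  simp only [one_mul, zero_mul, abs_zero, ENNReal.ofReal_zero, lintegral_const, mul_zero, add_zero]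
  exact ENNReal.add_ne_top.2 ⟨ENNReal.mul_ne_top ENNReal.ofReal_ne_top
    (ENNReal.mul_ne_top ENNReal.ofReal_ne_top hfin), ENNReal.mul_ne_top ENNReal.ofReal_ne_top
    (ENNReal.mul_ne_top ENNReal.ofReal_ne_top hfin)⟩

lemma ae_markLaw_nonneg (p q : unitInterval) : ∀ᵐ m ∂(markLaw p q), 0 ≤ m.2.1 ∧ 0 ≤ m.2.2 := by
  have hs : MeasurableSet {m : Mark | 0 ≤ m.2.1 ∧ 0 ≤ m.2.2} :=
    (measurableSet_Ici.prod measurableSet_Ici).preimage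
      (measurable_snd : Measurable fun m : Mark => m.2)
  have h0 : ∫⁻ m : Mark, ({m : Mark | 0 ≤ m.2.1 ∧ 0 ≤ m.2.2}ᶜ).indicator 1 m ∂(markLaw p q) = 0 := by
    have hm := (measurable_one : Measurable (1 : Mark → ℝ≥0∞)).indicator hs.compl
    have he : ∀ a : ℝ, 0 ≤ a → ∀ f : FilePortion, ∫⁻ x, ({m : Mark | 0 ≤ m.2.1 ∧ 0 ≤ m.2.2}ᶜ).indicator
        (1 : Mark → ℝ≥0∞) (f, a, x) ∂(expMeasure 1) = 0 := fun a ha f => by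
      rw [lintegral_expMeasure_one, setLIntegral_congr_fun measurableSet_Ioi (g := fun _ => 0)]
      · simp
      · intro x hx
        have : (f, a, x) ∉ {m : Mark | 0 ≤ m.2.1 ∧ 0 ≤ m.2.2}ᶜ := by
          simpa using ⟨ha, (mem_Ioi.1 hx).le⟩
        simp only [indicator_of_notMem this, mul_zero]
    have hmf : ∀ f : FilePortion, Measurable fun z : ℝ × ℝ =>
        ({m : Mark | 0 ≤ m.2.1 ∧ 0 ≤ m.2.2}ᶜ).indicator (1 : Mark → ℝ≥0∞) (f, z) := fun f =>
      hm.comp measurable_prodMk_left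
    rw [markLaw, lintegral_prod _ hm.aemeasurable, lintegral_bernoulliMeasure,
      lintegral_prod _ (hmf _).aemeasurable, lintegral_prod _ (hmf _).aemeasurable,
      lintegral_bernoulliMeasure, lintegral_bernoulliMeasure]
    simp [he 0 le_rfl, he 1 zero_le_one]
  rw [lintegral_indicator_one hs.compl] at h0
  exact mem_ae_iff.2 h0

variable {Ω : Type*} [MeasurableSpace Ω] {P : Measure Ω} {lam : ℝ} {p q : unitInterval}
  {X : ℕ → Ω → Plane} {file : ℕ → Ω → FilePortion} {t h : ℕ → Ω → ℝ}

namespace IsCachingNetwork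

lemma ae_nonneg (hnet : IsCachingNetwork P lam p q X file t h) :
    ∀ᵐ ω ∂P, ∀ n, 0 ≤ t n ω ∧ 0 ≤ h n ω := by
  refine ae_all_iff.2 fun n => ?_
  have := ae_markLaw_nonneg p q
  rw [markLaw, ← (hnet.mark_law n).map_eq] at this
  exact ae_of_ae_map (hnet.measurable_mark n).aemeasurable this

/-- The total received power of all devices, whatever they cache, is almost surely finite. -/
lemma ae_summable [IsProbabilityMeasure P] (hnet : IsCachingNetwork P lam p q X file t h)
    {α : ℝ} (hα : 2 < α) :
    ∀ᵐ ω ∂P, Summable fun n => |t n ω * h n ω| * ‖X n ω‖ ^ (-α) := by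
  have hfar : Measurable fun y => ENNReal.ofReal (farGain α y) := (measurable_farGain α).ennreal_ofReal
  have hM : Measurable fun m : Mark => ENNReal.ofReal |m.2.1 * m.2.2| := by fun_prop
  have hm1 : ∀ n, Measurable fun ω => ENNReal.ofReal |t n ω * h n ω| := fun n =>
    hM.comp (hnet.measurable_mark n)
  have hm2 : ∀ n, Measurable fun ω => ENNReal.ofReal (farGain α (X n ω)) := fun n =>
    hfar.comp (hnet.ppp.measurable_point n)
  have hm12 : ∀ n, Measurable fun ω =>
      ENNReal.ofReal |t n ω * h n ω| * ENNReal.ofReal (farGain α (X n ω)) := fun n =>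
    (hm1 n).mul (hm2 n)
  have hindep : ∀ n, IndepFun (fun ω => ENNReal.ofReal |t n ω * h n ω|)
      (fun ω => ENNReal.ofReal (farGain α (X n ω))) P := fun n =>
    (hnet.position_indep_mark.comp (φ := fun x : ℕ → Plane => ENNReal.ofReal (farGain α (x n)))
      (ψ := fun m : ℕ → Mark => ENNReal.ofReal |(m n).2.1 * (m n).2.2|)
      (hfar.comp (measurable_pi_apply n)) (hM.comp (measurable_pi_apply n))).symm
  -- Only the far field is averaged, because `‖y‖ ^ (-α)` is not integrable at the origin when `α >
  -- 2`.
  have hfin : ∫⁻ ω, ∑' n, ENNReal.ofReal |t n ω * h n ω| * ENNReal.ofReal (farGain α (X n ω)) ∂P ≠ ⊤ := by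
    rw [MeasureTheory.lintegral_tsum fun n => (hm12 n).aemeasurable]
    have : ∀ n, ∫⁻ ω, ENNReal.ofReal |t n ω * h n ω| * ENNReal.ofReal (farGain α (X n ω)) ∂P =
        (∫⁻ m : Mark, ENNReal.ofReal |m.2.1 * m.2.2| ∂(markLaw p q)) *
          ∫⁻ ω, ENNReal.ofReal (farGain α (X n ω)) ∂P := fun n => by
      rw [← hnet.lintegral_mark n hM]
      exact lintegral_mul_eq_lintegral_mul_lintegral_of_indepFun (hm1 n) (hm2 n) (hindep n)
    simp_rw [this]
    rw [ENNReal.tsum_mul_left, hnet.ppp.lintegral_tsum hfar]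
    exact ENNReal.mul_ne_top (lintegral_abs_mark_ne_top p q)
      (ENNReal.mul_ne_top ENNReal.ofReal_ne_top (lintegral_farGain_ne_top hα))
  have hmeas : Measurable fun ω =>
      ∑' n, ENNReal.ofReal |t n ω * h n ω| * ENNReal.ofReal (farGain α (X n ω)) :=
    Measurable.tsum hm12
  filter_upwards [ae_lt_top hmeas hfin, hnet.ppp.ae_locally_finite 0] with ω hω hlf
  have hs : Summable fun n => |t n ω * h n ω| * farGain α (X n ω) := by
    have := ENNReal.summable_toReal hω.ne
    refine this.congr fun n => ?_
    rw [← ENNReal.ofReal_mul (abs_nonneg _),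
      ENNReal.toReal_ofReal (mul_nonneg (abs_nonneg _) (farGain_nonneg _ _))]
  -- Only finitely many devices lie in the unit disc, and finitely many terms do not affect
  -- summability.
  refine hs.congr_cofinite ?_
  have : ∀ᶠ n in cofinite, n ∉ {n | X n ω ∈ Metric.closedBall (0 : Plane) 1} :=
    (hlf 1).eventually_cofinite_notMem
  filter_upwards [this] with n hn
  have : 1 < ‖X n ω‖ := by simpa using hn
  rw [farGain, if_pos this.le]

end IsCachingNetwork

/-- The factor `2` in the exponent comes from the symmetry of the arc about the axis through the two
locations. Positivity of `r₁` enters in squaring the condition that describes the disc. -/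
lemma outerMean_meanWeight [IsProbabilityMeasure P] (hX : IsHomogeneousPPP P lam X)
    (hlam : 0 < lam) {v r₁ s α : ℝ} (hv : 0 ≤ v) (hr₁ : 0 < r₁) (hs : 0 < s) (hα : 2 < α) :
    outerMean P X (location1 v) (meanWeight p q s α) r₁ =
      ENNReal.ofReal (laplaceTwo lam (1 - (p : ℝ)) q α v s r₁) := by
  classical
  obtain ⟨-, -, hint, heq⟩ := integral_arc hv hr₁ hs hα
  have hpq : 0 ≤ (1 - (p : ℝ)) * q := mul_nonneg (by linarith [p.2.2]) q.2.1
  rw [hX.outerMean_eq hlam (measurable_meanWeight p q s α) (meanWeight_le_one p q hs.le α)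
    (lintegral_one_sub_meanWeight_ne_top p q hs hα)]
  have hnn : ∀ r : ℝ, 0 < r → 0 ≤ 1 / (1 + r ^ α / s) := fun r hr => by
    have := Real.rpow_pos_of_pos hr α
    positivity
  have h1 : ∫⁻ x, (1 - cutOff (location1 v) (meanWeight p q s α) r₁ x) =
      ∫⁻ x : Plane, (if x ∈ Metric.closedBall (location1 v) r₁ then 0 else
        ENNReal.ofReal ((1 - (p : ℝ)) * q * (1 / (1 + ‖x‖ ^ α / s)))) := by
    refine lintegral_congr_ae ?_
    filter_upwards [compl_mem_ae_iff.2 (measure_singleton (0 : Plane))] with x hx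
    unfold cutOff
    split_ifs
    · simp
    · exact one_sub_meanWeight p q hs hx
  rw [h1, lintegral_outside_disc hv hr₁ (φ := fun r => (1 - (p : ℝ)) * q * (1 / (1 + r ^ α / s)))
    (by fun_prop) fun r hr => mul_nonneg hpq (hnn r hr)]
  have h2 : ∀ r, 2 * ((Real.pi - arc v r₁ r) * (r * ((1 - (p : ℝ)) * q * (1 / (1 + r ^ α / s))))) =
      2 * ((1 - (p : ℝ)) * q) * ((Real.pi - arc v r₁ r) * (r * (1 / (1 + r ^ α / s)))) := fun r => by
    ring
  simp_rw [h2]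
  rw [← ofReal_integral_eq_lintegral_ofReal (hint.const_mul _)
    (ae_restrict_of_forall_mem measurableSet_Ioi fun r (hr : 0 < r) =>
      mul_nonneg (by positivity) (mul_nonneg (sub_nonneg.2 (arc_le_pi _ _ _))
        (mul_nonneg hr.le (hnn r hr)))), integral_const_mul, heq, ENNReal.toReal_ofReal, laplaceTwo]
  · congr 2
    ring
  · rw [← heq]
    exact mul_nonneg (by positivity) (setIntegral_nonneg measurableSet_Ioi fun r (hr : 0 < r) =>
      mul_nonneg (sub_nonneg.2 (arc_le_pi _ _ _)) (mul_nonneg hr.le (hnn r hr)))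

end D2DCaching

/-! ### The Laplace transforms of the interference. -/

namespace D2DCaching

variable {Ω : Type*} [MeasurableSpace Ω] {P : Measure Ω} {lam : ℝ} {p q : unitInterval}
  {X : ℕ → Ω → Plane} {file : ℕ → Ω → FilePortion} {t h : ℕ → Ω → ℝ}

lemma subcaseY_eq {Ω : Type*} (v : ℝ) (X : ℕ → Ω → Plane) (file : ℕ → Ω → FilePortion) (t h : ℕ → Ω → ℝ) :
    subcaseY v X file =
      {ω | ((fun n => X n ω, fun n => (file n ω, t n ω, h n ω)) :
        (ℕ → Plane) × (ℕ → Mark)) ∈ closestB (location1 v)} := by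
  ext ω
  simp only [subcaseY, closestB, mem_ofPred_eq, minDist, le_ciInf_iff (bddBelow_dist _ _)]

namespace IsCachingNetwork

lemma measurable_position_mark (hnet : IsCachingNetwork P lam p q X file t h) :
    Measurable fun ω => ((fun n => X n ω, fun n => (file n ω, t n ω, h n ω)) :
      (ℕ → Plane) × (ℕ → Mark)) :=
  (measurable_pi_lambda _ hnet.ppp.measurable_point).prodMk
    (measurable_pi_lambda _ hnet.measurable_mark)

lemma ae_summable_interferenceTerm [IsProbabilityMeasure P]
    (hnet : IsCachingNetwork P lam p q X file t h) {α : ℝ} (hα : 2 < α) (v : ℝ) :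
    ∀ᵐ ω ∂P, ∀ r₁ : ℝ, Summable (interferenceTerm α v r₁ X file t h ω) := by
  filter_upwards [hnet.ae_summable hα] with ω hω r₁
  refine Summable.of_norm_bounded hω fun n => ?_
  have hn : 0 ≤ ‖X n ω‖ ^ (-α) := by positivity
  unfold interferenceTerm
  split_ifs
  · rw [norm_mul, Real.norm_of_nonneg hn, Real.norm_eq_abs]
  · rw [norm_zero]
    positivity

/-- The exceptional null set does not depend on the radius, so that the random radius
`servingDistance v X ω` may be inserted. -/
lemma ae_exp_interferenceTwo [IsProbabilityMeasure P]
    (hnet : IsCachingNetwork P lam p q X file t h) {α : ℝ} (hα : 2 < α) (v : ℝ) {s : ℝ}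
    (hs : 0 ≤ s) :
    ∀ᵐ ω ∂P, ∀ r₁ : ℝ, Real.exp (-s * interferenceTwo α v r₁ X file t h ω) =
      (infProd fun n => cutOff (location1 v)
        (fun y => weight s α y (file n ω, t n ω, h n ω)) r₁ (X n ω)).toReal := by
  filter_upwards [hnet.ae_summable_interferenceTerm hα v, hnet.ae_nonneg] with ω hsum hnn r₁
  have h0 : ∀ n, 0 ≤ interferenceTerm α v r₁ X file t h ω n := fun n => by
    have := hnn n
    unfold interferenceTerm
    split_ifs
    · exact mul_nonneg (mul_nonneg this.1 this.2) (by positivity)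
    · exact le_rfl
  have hterm : ∀ n, cutOff (location1 v) (fun y => weight s α y (file n ω, t n ω, h n ω)) r₁
      (X n ω) = ENNReal.ofReal (Real.exp (-(s * interferenceTerm α v r₁ X file t h ω n))) := by
    intro n
    have := mul_nonneg (hnn n).1 (hnn n).2
    unfold cutOff weight interferenceTerm
    by_cases hB : file n ω = FilePortion.B <;>
      by_cases hx : X n ω ∈ Metric.closedBall (location1 v) r₁ <;>
      simp [hB, hx, abs_of_nonneg this, -Metric.mem_closedBall]
  simp_rw [hterm]
  rw [infProd_exp (fun n => mul_nonneg hs (h0 n)) ((hsum r₁).mul_left s), tsum_mul_left,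
    ENNReal.toReal_ofReal (Real.exp_pos _).le, neg_mul, interferenceTwo]

lemma measurable_infProd_weight_serving (hnet : IsCachingNetwork P lam p q X file t h)
    (v s α : ℝ) : Measurable fun ω => infProd fun n => cutOff (location1 v)
      (fun y => weight s α y (file n ω, t n ω, h n ω)) (servingDistance v X ω) (X n ω) := by
  have h := (measurable_infProd_weight (location1 v) s α
    ((measurable_minDist (location1 v)).comp measurable_fst)).comp hnet.measurable_position_mark
  simp only [Function.comp_def] at h
  exact h

lemma measurable_infProd_weight_fixed (hnet : IsCachingNetwork P lam p q X file t h)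
    (v r s α : ℝ) : Measurable fun ω => infProd fun n => cutOff (location1 v)
      (fun y => weight s α y (file n ω, t n ω, h n ω)) r (X n ω) := by
  have h := (measurable_infProd_weight (location1 v) s α (ρ := fun _ => r)
    measurable_const).comp hnet.measurable_position_mark
  simp only [Function.comp_def] at h
  exact h

lemma integral_exp_interferenceTwo [IsProbabilityMeasure P]
    (hnet : IsCachingNetwork P lam p q X file t h) (hlam : 0 < lam) {α : ℝ} (hα : 2 < α) {v : ℝ}
    (hv : 0 ≤ v) {s : ℝ} (hs : 0 < s) {r₁ : ℝ} (hr₁ : 0 < r₁) :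
    ∫ ω, Real.exp (-s * interferenceTwo α v r₁ X file t h ω) ∂P =
      laplaceTwo lam (1 - (p : ℝ)) q α v s r₁ := by
  have hae := (hnet.ae_exp_interferenceTwo hα v hs.le).mono fun ω hω => hω r₁
  rw [integral_congr_ae hae, integral_toReal
    (hnet.measurable_infProd_weight_fixed v r₁ s α).aemeasurable
    (ae_of_all _ fun ω => (infProd_ne_top _).lt_top), hnet.lintegral_infProd_weight _ hs.le,
    outerMean_meanWeight hnet.ppp hlam hv hr₁ hs hα, laplaceTwo,
    ENNReal.toReal_ofReal (Real.exp_pos _).le]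

lemma ae_servingDistance_pos (hnet : IsCachingNetwork P lam p q X file t h) (v : ℝ) :
    ∀ᵐ ω ∂P, 0 < servingDistance v X ω := by
  filter_upwards [hnet.ppp.ae_locally_finite (location1 v), hnet.ppp.ae_ne (location1 v)]
    with ω hω hne
  obtain ⟨n, hn⟩ := exists_dist_eq_minDist hω
  exact (dist_pos.2 (hne n).symm).trans_eq hn

/-- The serving distance is independent of the subcase. -/
lemma setLIntegral_subcaseY [IsProbabilityMeasure P]
    (hnet : IsCachingNetwork P lam p q X file t h) (hlam : 0 < lam) (v : ℝ) {ψ : ℝ → ℝ≥0∞}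
    (hψ : Measurable ψ) :
    ∫⁻ ω in subcaseY v X file, ψ (servingDistance v X ω) ∂P =
      ENNReal.ofReal (1 - p) * ∫⁻ ω, ψ (servingDistance v X ω) ∂P := by
  -- At `s = 0` every factor is `1`, and only the mark of the closest device is left in
  -- `setLIntegral_closestB`.
  have hw : ∀ y m, weight 0 0 y m = 1 := fun y m => by simp [weight]
  have hmw : meanWeight p q 0 0 = fun _ => 1 := by
    funext y; simp [meanWeight, hw]
  have hcut : ∀ r y, cutOff (location1 v) (fun _ => 1) r y = 1 := fun r y => by simp [cutOff]
  have := hnet.setLIntegral_closestB hlam (location1 v) le_rfl 0 hψ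
  simp only [hw, hmw, hcut, infProd_one, mul_one] at this
  rw [subcaseY_eq v X file t h]
  exact this

/-- The subcase is first traded for the factor `1 - p` together with averaged marks, then the
product is replaced by its mean given the serving distance, and finally `1 - p` is turned back into
the subcase. -/
lemma setLIntegral_infProd_weight [IsProbabilityMeasure P]
    (hnet : IsCachingNetwork P lam p q X file t h) (hlam : 0 < lam) {α : ℝ} (hα : 2 < α) (v : ℝ)
    {s : ℝ} (hs : 0 < s) {A : Set ℝ} (hA : MeasurableSet A) :
    ∫⁻ ω in servingDistance v X ⁻¹' A ∩ subcaseY v X file, infProd (fun n =>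
        cutOff (location1 v) (fun y => weight s α y (file n ω, t n ω, h n ω))
          (servingDistance v X ω) (X n ω)) ∂P =
      ∫⁻ ω in servingDistance v X ⁻¹' A ∩ subcaseY v X file,
        outerMean P X (location1 v) (meanWeight p q s α) (servingDistance v X ω) ∂P := by
  have hR : Measurable (servingDistance v X) := hnet.ppp.measurable_minDist (location1 v)
  have hS : MeasurableSet (servingDistance v X ⁻¹' A) := hR hA
  have hind : ∀ (Q : Measure Ω) (F : Ω → ℝ≥0∞), ∫⁻ ω in servingDistance v X ⁻¹' A, F ω ∂Q =
      ∫⁻ ω, A.indicator 1 (servingDistance v X ω) * F ω ∂Q := fun Q F => by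
    rw [← lintegral_indicator hS]
    refine lintegral_congr fun ω => ?_
    by_cases hω : servingDistance v X ω ∈ A <;> simp [indicator, hω]
  have hA1 : Measurable (A.indicator (1 : ℝ → ℝ≥0∞)) := measurable_one.indicator hA
  have hOM : Measurable (outerMean P X (location1 v) (meanWeight p q s α)) :=
    (monotone_outerMean (meanWeight_le_one p q hs.le α)).measurable
  have h1 := hnet.setLIntegral_closestB hlam (location1 v) hs.le α hA1
  rw [← subcaseY_eq v X file t h] at h1
  have h2 := hnet.ppp.setLIntegral_minDist hlam (c := location1 v) (measurable_meanWeight p q s α)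
    (meanWeight_le_one p q hs.le α) (lintegral_one_sub_meanWeight_ne_top p q hs hα) hA
  have h3 := hnet.setLIntegral_subcaseY hlam v (hA1.mul hOM)
  rw [← Measure.restrict_restrict hS, hind, hind]
  refine h1.trans (Eq.trans ?_ h3.symm)
  congr 1
  exact (hind P _).symm.trans (h2.trans (hind P _))

/-- The Laplace transform of the interference under subcase Y, given the serving distance. -/
theorem condExp_interferenceTwo [IsProbabilityMeasure P]
    (hnet : IsCachingNetwork P lam p q X file t h) (hlam : 0 < lam) {α : ℝ} (hα : 2 < α)
    {v : ℝ} (hv : 0 ≤ v) {s : ℝ} (hs : 0 < s) :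
    (P[|subcaseY v X file])[fun ω =>
        Real.exp (-s * interferenceTwo α v (servingDistance v X ω) X file t h ω) |
        MeasurableSpace.comap (servingDistance v X) inferInstance]
      =ᵐ[P[|subcaseY v X file]]
        fun ω => laplaceTwo lam (1 - (p : ℝ)) q α v s (servingDistance v X ω) := by
  -- If the subcase is null, as for `p = 1`, the conditional measure is `0` and nothing is to be
  -- shown.
  by_cases hY : P (subcaseY v X file) = 0
  · rw [cond_eq_zero_of_meas_eq_zero hY]
    rw [EventuallyEq, ae_zero]
    exact eventually_bot
  have : IsProbabilityMeasure (P[|subcaseY v X file]) := cond_isProbabilityMeasure hY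
  set μ := P[|subcaseY v X file] with hμ
  have hμP : μ ≪ P := cond_absolutelyContinuous
  have hR : Measurable (servingDistance v X) := hnet.ppp.measurable_minDist (location1 v)
  let F : Ω → ℝ≥0∞ := fun ω => infProd fun n => cutOff (location1 v)
    (fun y => weight s α y (file n ω, t n ω, h n ω)) (servingDistance v X ω) (X n ω)
  let L : ℝ → ℝ≥0∞ := outerMean P X (location1 v) (meanWeight p q s α)
  have hF : Measurable F := hnet.measurable_infProd_weight_serving v s α
  have hL : Measurable L := (monotone_outerMean (meanWeight_le_one p q hs.le α)).measurable
  have hF1 : ∀ ω, F ω ≤ 1 := fun ω => infProd_le_one _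
  have hL1 : ∀ r, L r ≤ 1 := fun r => outerMean_le_one _ _ _
  have hint : ∀ G : Ω → ℝ≥0∞, Measurable G → (∀ ω, G ω ≤ 1) →
      Integrable (fun ω => (G ω).toReal) μ := fun G hG hG1 =>
    Integrable.of_bound hG.ennreal_toReal.aestronglyMeasurable 1 (ae_of_all _ fun ω => by
      rw [Real.norm_of_nonneg ENNReal.toReal_nonneg]
      simpa using ENNReal.toReal_mono ENNReal.one_ne_top (hG1 ω))
  have hf : (fun ω => Real.exp (-s * interferenceTwo α v (servingDistance v X ω) X file t h ω))
      =ᵐ[μ] fun ω => (F ω).toReal :=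
    hμP.ae_le ((hnet.ae_exp_interferenceTwo hα v hs.le).mono fun ω hω => hω _)
  have hg : (fun ω => laplaceTwo lam (1 - (p : ℝ)) q α v s (servingDistance v X ω))
      =ᵐ[μ] fun ω => (L (servingDistance v X ω)).toReal :=
    hμP.ae_le ((hnet.ae_servingDistance_pos v).mono fun ω hω => by
      simp only [L]
      rw [outerMean_meanWeight hnet.ppp hlam hv hω hs hα, laplaceTwo,
        ENNReal.toReal_ofReal (Real.exp_pos _).le])
  have hset : ∀ G : Ω → ℝ≥0∞, Measurable G → (∀ ω, G ω ≤ 1) → ∀ S,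
      ∫ ω in S, (G ω).toReal ∂μ = (∫⁻ ω in S, G ω ∂μ).toReal := fun G hG hG1 S =>
    integral_toReal hG.aemeasurable
      (ae_of_all _ fun ω => (hG1 ω).trans_lt ENNReal.one_lt_top)
  refine (condExp_congr_ae hf).trans (EventuallyEq.trans ?_ hg.symm)
  refine (ae_eq_condExp_of_forall_setIntegral_eq hR.comap_le (hint F hF hF1)
    (fun S _ _ => (hint _ (hL.comp hR) fun ω => hL1 _).integrableOn) ?_ ?_).symm
  · rintro _ ⟨A, hA, rfl⟩ -
    have hS : MeasurableSet (servingDistance v X ⁻¹' A) := hR hA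
    refine (hset _ (hL.comp hR) (fun ω => hL1 _) _).trans ((hset F hF hF1 _).trans ?_).symm
    congr 1
    -- The normalisation by the probability of the subcase is the same constant on both sides.
    rw [hμ, ProbabilityTheory.cond, Measure.restrict_smul, lintegral_smul_measure,
      lintegral_smul_measure, Measure.restrict_restrict hS]
    congr 1
    exact hnet.setLIntegral_infProd_weight hlam hα v hs hA
  · exact ((hL.ennreal_toReal.comp (comap_measurable _)).stronglyMeasurable).aestronglyMeasurable

end IsCachingNetwork
end D2DCaching

theorem lemma3 {Ω : Type*} [MeasurableSpace Ω] (P : Measure Ω) [IsProbabilityMeasure P]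
    (lam : ℝ) (hlam : 0 < lam) (p q : unitInterval) (α : ℝ) (hα : 2 < α)
    (v : ℝ) (hv : 0 ≤ v)
    (X : ℕ → Ω → D2DCaching.Plane) (file : ℕ → Ω → D2DCaching.FilePortion) (t h : ℕ → Ω → ℝ)
    (hnet : D2DCaching.IsCachingNetwork P lam p q X file t h)
    (s : ℝ) (hs : 0 < s) :
    -- the interference is almost surely finite, whatever the radius of the exclusion disc
    (∀ᵐ ω ∂P, ∀ r₁ : ℝ, Summable (D2DCaching.interferenceTerm α v r₁ X file t h ω)) ∧
    -- for every radius, the integrals converge and give the Laplace transform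
    (∀ r₁ : ℝ, 0 < r₁ →
      IntegrableOn (fun r : ℝ => Real.pi * r / (1 + r ^ α / s)) (Ioi (max 0 (r₁ - v))) ∧
      IntervalIntegrable (fun r : ℝ => D2DCaching.angle v r r₁ * r / (1 + r ^ α / s)) volume
        |v - r₁| (v + r₁) ∧
      ∫ ω, Real.exp (-s * D2DCaching.interferenceTwo α v r₁ X file t h ω) ∂P =
        D2DCaching.laplaceTwo lam (1 - (p : ℝ)) q α v s r₁) ∧
    -- under subcase Y, the Laplace transform conditional on the serving distance
    (P[|D2DCaching.subcaseY v X file])[fun ω =>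
        Real.exp (-s * D2DCaching.interferenceTwo α v (D2DCaching.servingDistance v X ω)
          X file t h ω) |
        MeasurableSpace.comap (D2DCaching.servingDistance v X) inferInstance]
      =ᵐ[P[|D2DCaching.subcaseY v X file]]
        fun ω => D2DCaching.laplaceTwo lam (1 - (p : ℝ)) q α v s
          (D2DCaching.servingDistance v X ω) := by

  refine ⟨hnet.ae_summable_interferenceTerm hα v, fun r₁ hr₁ => ?_,
    hnet.condExp_interferenceTwo hlam hα hv hs⟩
  obtain ⟨h1, h2, -⟩ := D2DCaching.integral_arc hv hr₁ hs hα
  exact ⟨h1, h2, hnet.integral_exp_interferenceTwo hlam hα hv hs hr₁⟩
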